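/- Consider the Transport–Stokes system in $\mathbb{R}^3$ $$-\Delta u+\nabla p=-\rho\, e_3,\qquad \operatorname{div}u=0,\qquad \partial_t\rho+\operatorname{div}(\rho u)=0,\qquad \rho(0)=\rho_0,\qquad \lim_{|x|\to\infty}u(t,x)=0 .$$ Solutions are Lagrangian solutions among probability densities on $\mathbb{R}^3$ bounded locally uniformly in time: for each $t\ge 0$ the velocity $u(t,\cdot)$ is continuous, tends to $0$ at infinity and solves the Stokes equations in the sense of distributions with some pressure $p(t,\cdot)\in L^1_{loc}$, and $\rho(t)=X(t,\cdot)_\#\rho_0$, where $\partial_tX(t,x)=u(t,X(t,x))$, $X(0,x)=x$. Let $W_1(\mu,\nu)=\sup\{|\int f\,d\mu-\int f\,d\nu| : [f]_{\mathrm{Lip}}\le 1\}$ be the first Wasserstein distance, where the supremum is over the $f$ integrable for both measures. For $R>0$ let $\rho_{R,0}=\mathbf 1_{B(0,R)}/|B(0,R)|$, and let $$\rho_R(t,x)=\frac1{R^3}\,\rho_{1,0}\!\left(\frac xR-\frac{t}{|B(0,1)|R^2}\,c\right),\qquad c=-\tfrac4{15}e_3 .$$ **Proposition.** Let $R>0$.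 The travelling wave $\rho_R$ is the unique solution of the Transport–Stokes system with initial datum $\rho_{R,0}$, and it is unstable for $W_1$: there is $\varepsilon>0$ such that for every $\eta>0$ there are an initial datum $\bar\rho_0\in\mathcal P(\mathbb{R}^3)\cap L^\infty(\mathbb{R}^3)$, which has a unique solution $\bar\rho$, and a time $T>0$ with $$W_1(\bar\rho_0,\rho_{R,0})<\eta\qquad\text{and}\qquad W_1(\bar\rho(t),\rho_R(t))>\varepsilon\quad\text{for all }t\ge T .$$ More precisely, for every $R'>0$ (for which, likewise, $\rho_{R'}$ is the unique solution with initial datum $\rho_{R',0}$), $$W_1(\rho_{R',0},\rho_{R,0})\le |R'-R|\int|x|\,\rho_{1,0}(x)\,dx,$$ and for all $t\ge0$ $$\frac{4}{15}\,\frac{t}{|B(0,1)|}\left|\frac1{R'}-\frac1R\right|\ \le\ W_1(\rho_{R'}(t),\rho_R(t))\ \le\ |R'-R|\int|x|\,\rho_{1,0}(x)\,dx+\frac{4}{15}\,\frac{t}{|B(0,1)|}\left|\frac1{R'}-\frac1R\right| .$$ -/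

import Mathlib

open MeasureTheory Filter Topology Set Metric
open scoped ENNReal NNReal ContDiff InnerProductSpace

noncomputable section

/-- Three-dimensional Euclidean space. -/
abbrev Space : Type := EuclideanSpace ℝ (Fin 3)

/-- The upward vertical unit vector `e₃`. -/
def e₃ : Space := EuclideanSpace.single 2 1

/-- The divergence of a differentiable vector field. -/
def divergence (φ : Space → Space) (x : Space) : ℝ :=
  ∑ i, (fderiv ℝ φ x (EuclideanSpace.single i 1)) i

/-- `u` solves the steady Stokes system
`-Δu + ∇p = -ρ e₃`, `div u = 0` in `ℝ³`, `u(x) → 0` as `|x| → ∞`,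
for some pressure `p ∈ L¹_loc`, in the sense of distributions. For a bounded density such a `u`
has a continuous representative; `u` is that representative, so that its flow makes sense. -/
structure IsStokesVelocity (ρ : Measure Space) (u : Space → Space) : Prop where
  continuous : Continuous u
  tendsto_zero : Tendsto u (cocompact Space) (𝓝 0)
  div_eq_zero : ∀ ψ : Space → ℝ, ContDiff ℝ ∞ ψ → HasCompactSupport ψ →
    ∫ x, ⟪u x, gradient ψ x⟫_ℝ = 0
  momentum : ∃ p : Space → ℝ, LocallyIntegrable p ∧
    ∀ φ : Space → Space, ContDiff ℝ ∞ φ → HasCompactSupport φ →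
      -(∫ x, ⟪u x, (Laplacian.laplacian φ : Space → Space) x⟫_ℝ) - ∫ x, p x * divergence φ x
        = -∫ x, ⟪e₃, φ x⟫_ℝ ∂ρ

/-- Membership in `𝒫(ℝ³) ∩ L^∞(ℝ³)`: a probability measure with a bounded density. -/
def IsBoundedProbability (μ : Measure Space) : Prop :=
  IsProbabilityMeasure μ ∧ ∃ C : ℝ≥0, μ ≤ C • (volume : Measure Space)

/-- `ρ` (a curve of measures, relevant for `t ≥ 0` only) is a Lagrangian solution of the
Transport–Stokes system
`-Δu + ∇p = -ρ e₃`, `div u = 0`, `∂ₜρ + div (ρ u) = 0`, `ρ(0) = ρ₀`, `u → 0` at infinity,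
in the class of probability densities bounded locally uniformly in time:
`ρ(t)` is transported by the flow `X` of the Stokes velocity `u` that it generates. -/
structure IsTransportStokesSolution (ρ₀ : Measure Space) (ρ : ℝ → Measure Space) : Prop where
  isProbabilityMeasure : ∀ t, 0 ≤ t → IsProbabilityMeasure (ρ t)
  bounded : ∀ T : ℝ, ∃ C : ℝ≥0, ∀ t ∈ Icc 0 T, ρ t ≤ C • (volume : Measure Space)
  initial : ρ 0 = ρ₀
  transport : ∃ u X : ℝ → Space → Space,
    (∀ t, 0 ≤ t → IsStokesVelocity (ρ t) (u t)) ∧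
    (∀ x, X 0 x = x) ∧
    (∀ t, 0 ≤ t → ∀ x, HasDerivWithinAt (fun s => X s x) (u t (X t x)) (Ici 0) t) ∧
    (∀ t, 0 ≤ t → Measurable (X t)) ∧
    (∀ t, 0 ≤ t → ρ t = ρ₀.map (X t))

/-- `ρ` is the unique solution of the Transport–Stokes system with initial datum `ρ₀`. -/
def IsUniqueTransportStokesSolution (ρ₀ : Measure Space) (ρ : ℝ → Measure Space) : Prop :=
  IsTransportStokesSolution ρ₀ ρ ∧
    ∀ ρ' : ℝ → Measure Space, IsTransportStokesSolution ρ₀ ρ' → ∀ t, 0 ≤ t → ρ' t = ρ t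

/-- The first Wasserstein distance of two probability measures,
`sup { |∫ f dμ - ∫ f dν| : [f]_Lip ≤ 1 }`, over the `f` that both measures integrate
(all of them if both have a finite first moment). -/
def W₁ (μ ν : Measure Space) : ℝ≥0∞ :=
  ⨆ (f : Space → ℝ) (_ : LipschitzWith 1 f) (_ : Integrable f μ) (_ : Integrable f ν),
    ENNReal.ofReal |∫ x, f x ∂μ - ∫ x, f x ∂ν|

/-- The uniform probability distribution `1_{B(a,r)} / |B(a,r)|` on a ball. -/
def uniformBall (a : Space) (r : ℝ) : Measure Space :=
  (volume (ball a r))⁻¹ • volume.restrict (ball a r)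

/-- The initial datum `ρ_{R,0} = 1_{B(0,R)} / |B(0,R)|`. -/
def patch (R : ℝ) : Measure Space := uniformBall 0 R

/-- The traveling wave `ρ_R(t,x) = R⁻³ ρ_{1,0}(x/R - t c / (|B(0,1)| R²))`, with
`c = -(4/15) e₃`: the uniform distribution on the ball of radius `R` that moves with the
constant velocity `c / (|B(0,1)| R)`. -/
def travelingWave (R t : ℝ) : Measure Space :=
  uniformBall ((t / (volume.real (ball (0 : Space) 1) * R)) • (-(4 / 15 : ℝ) • e₃)) R

/-- Instability of the solution `ρ` for the first Wasserstein metric: there is a threshold `ε`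
such that arbitrarily close to `ρ(0)` there are bounded probability densities whose unique
solution stays at distance more than `ε` from `ρ(t)` for all large times `t`. -/
def IsW₁Unstable (ρ : ℝ → Measure Space) : Prop :=
  ∃ ε : ℝ≥0∞, 0 < ε ∧ ∀ η : ℝ≥0∞, 0 < η →
    ∃ (σ₀ : Measure Space) (σ : ℝ → Measure Space),
      IsBoundedProbability σ₀ ∧ IsUniqueTransportStokesSolution σ₀ σ ∧
      W₁ σ₀ (ρ 0) < η ∧ ∃ T : ℝ, 0 < T ∧ ∀ t, T ≤ t → ε < W₁ (σ t) (ρ t)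

end

/-!
Existence, uniqueness and instability of the travelling balls of the Transport–Stokes system.

*Existence.* For the density `q 1_{B(0,R)}` let `G` be its Newtonian potential (`potential`) and `Φ`
the radial function with `ΔΦ = G`. The Stokes velocity is `u = G e₃ - ∇∂₃Φ` with pressure `-∂₃G`.
All functions involved are polynomials in the contraction factor `s = R / max(|x|, R)` and in the
projection `s x` of `x` to the ball, hence globally Lipschitz, and the weak equations follow from
integration by parts for Lipschitz functions and from pointwise identities off the sphere
(`isStokesVelocity_ballVelocity`). On the sphere the normal component of `u` is that of a constant
vector, the drift. In the frame moving with the drift the flow of `u` leaves the ball invariant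
(`preimage_ball_of_isFlowOf`), and it preserves Lebesgue measure by Liouville's theorem for bounded
divergence free Lipschitz fields (`IsFlowOf.measurePreserving`). So the uniform distribution on the
ball is transported rigidly, although the flow is not rigid.

*Uniqueness.* Every Stokes velocity of a bounded probability density `ρ` is a constant multiple of
`K * ρ`, where `K` is the Stokes kernel (`IsStokesVelocity.mul_eq_integral_kernel`): the pressure is
eliminated by divergence free test fields `Δψ eᵢ - ∇∂ᵢψ`, which leaves an equation for `Δ²uᵢ`, and
`ψ` is a difference of two dilations of a smoothed norm, the fundamental solution of `Δ²` up to a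
factor. Since `|K(a) - K(b)| ≤ 6 |a - b| / (|a| |b|)` and `∫ |x - y|⁻² dρ(y)` is bounded in terms of
the density, the velocities of two solutions along their trajectories differ by at most a constant
times the largest distance of the two flows. Iterating this estimate shows that the flows of two
solutions with the same initial datum agree (`IsTransportStokesSolution.unique`).

*Instability.* A ball is an affine image of the unit ball, which bounds the Wasserstein distance of
two balls from above; testing with the vertical coordinate bounds it from below by the distance of
the heights of the centres. Balls of different radii move at different speeds, so that the latter
grows linearly in time (`isW₁Unstable_travelingWave`).
-/

/-! ### Partial derivatives -/

/-- The `i`-th unit vector of the standard basis. -/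
noncomputable def unitVec (i : Fin 3) : Space := EuclideanSpace.single i 1

/-- The `i`-th partial derivative of a function on `ℝ³`. -/
noncomputable def pd (i : Fin 3) (f : Space → ℝ) (x : Space) : ℝ := fderiv ℝ f x (unitVec i)

/-- The Laplacian of a real function, as the sum of the pure second partial derivatives. -/
noncomputable def lap (f : Space → ℝ) (x : Space) : ℝ := ∑ i, pd i (pd i f) x

lemma unitVec_apply (i j : Fin 3) : unitVec i j = if j = i then 1 else 0 := by
  simp [unitVec]

lemma e₃_eq : e₃ = unitVec 2 := rfl

lemma norm_unitVec (i : Fin 3) : ‖unitVec i‖ = 1 := by simp [unitVec]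

lemma inner_eq_sum (x y : Space) : ⟪x, y⟫_ℝ = ∑ i, x i * y i := by
  simp [PiLp.inner_apply, mul_comm]

lemma inner_unitVec (i : Fin 3) (x : Space) : ⟪unitVec i, x⟫_ℝ = x i := by
  simp [unitVec, EuclideanSpace.inner_single_left]

lemma abs_coord_le_norm (x : Space) (i : Fin 3) : |x i| ≤ ‖x‖ := by
  simpa using PiLp.norm_apply_le x i

lemma norm_sq_eq_sum (x : Space) : ‖x‖ ^ 2 = x 0 ^ 2 + x 1 ^ 2 + x 2 ^ 2 := by
  simp [EuclideanSpace.norm_sq_eq, Fin.sum_univ_three]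

section smooth

variable {f g : Space → ℝ}

lemma contDiff_pd (hf : ContDiff ℝ ∞ f) (i : Fin 3) : ContDiff ℝ ∞ (pd i f) :=
  (hf.fderiv_right (m := ∞) (by simp)).clm_apply contDiff_const

lemma contDiff_lap (hf : ContDiff ℝ ∞ f) : ContDiff ℝ ∞ (lap f) :=
  ContDiff.sum fun i _ => contDiff_pd (contDiff_pd hf i) i

lemma differentiable_of_smooth (hf : ContDiff ℝ ∞ f) : Differentiable ℝ f :=
  hf.differentiable (by simp)

lemma hasCompactSupport_pd (hf : HasCompactSupport f) (i : Fin 3) : HasCompactSupport (pd i f) :=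
  hf.fderiv_apply ℝ (unitVec i)

lemma hasCompactSupport_finsetSum {ι : Type*} (s : Finset ι) {F : ι → Space → ℝ}
    (hF : ∀ i, HasCompactSupport (F i)) : HasCompactSupport (fun x => ∑ i ∈ s, F i x) := by
  classical
  induction s using Finset.induction_on with
  | empty => exact (HasCompactSupport.zero : HasCompactSupport (0 : Space → ℝ))
  | insert a s ha ih =>
    simp only [Finset.sum_insert ha]
    exact (hF a).add ih

lemma hasCompactSupport_lap (hf : HasCompactSupport f) : HasCompactSupport (lap f) :=
  hasCompactSupport_finsetSum _ fun i => hasCompactSupport_pd (hasCompactSupport_pd hf i) i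

lemma pd_comm (hf : ContDiff ℝ ∞ f) (i j : Fin 3) (x : Space) :
    pd i (pd j f) x = pd j (pd i f) x := by
  have hd : DifferentiableAt ℝ (fderiv ℝ f) x :=
    ((hf.fderiv_right (m := ∞) (by simp)).differentiable (by simp)) x
  have key : ∀ a b : Fin 3, pd a (pd b f) x = fderiv ℝ (fderiv ℝ f) x (unitVec a) (unitVec b) := by
    intro a b
    have := (hd.hasFDerivAt.clm_apply (hasFDerivAt_const (unitVec b) x)).fderiv
    unfold pd
    rw [this]
    simp
  rw [key, key]
  exact (hf.contDiffAt.isSymmSndFDerivAt (by simpa using ENat.LEInfty.out)) _ _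

lemma pd_sub (hf : ContDiff ℝ ∞ f) (hg : ContDiff ℝ ∞ g) (i : Fin 3) (x : Space) :
    pd i (fun y => f y - g y) x = pd i f x - pd i g x := by
  unfold pd
  rw [fderiv_fun_sub (differentiable_of_smooth hf x) (differentiable_of_smooth hg x)]
  rfl

lemma pd_sum {ι : Type*} (s : Finset ι) {F : ι → Space → ℝ} (hF : ∀ j, ContDiff ℝ ∞ (F j))
    (i : Fin 3) (x : Space) : pd i (fun y => ∑ j ∈ s, F j y) x = ∑ j ∈ s, pd i (F j) x := by
  unfold pd
  rw [fderiv_fun_sum fun j _ => differentiable_of_smooth (hF j) x]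
  simp

lemma pd_const_mul (c : ℝ) (hf : ContDiff ℝ ∞ f) (i : Fin 3) (x : Space) :
    pd i (fun y => c * f y) x = c * pd i f x := by
  unfold pd
  rw [fderiv_const_mul (differentiable_of_smooth hf x)]
  rfl

/-- Partial derivatives of a rescaled and translated function. -/
lemma pd_comp_affine (hf : ContDiff ℝ ∞ f) (c : ℝ) (a : Space) (i : Fin 3) (x : Space) :
    pd i (fun y => f (c • (y - a))) x = c * pd i f (c • (x - a)) := by
  unfold pd
  have h1 : HasFDerivAt (fun y : Space => c • (y - a)) (c • ContinuousLinearMap.id ℝ Space) x :=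
    ((hasFDerivAt_id x).sub_const a).const_smul c
  have h2 := (differentiable_of_smooth hf (c • (x - a))).hasFDerivAt.comp x h1
  have h3 := h2.fderiv
  simp only [Function.comp_def] at h3
  rw [h3]
  simp

lemma contDiff_comp_affine (hf : ContDiff ℝ ∞ f) (c : ℝ) (a : Space) :
    ContDiff ℝ ∞ (fun y => f (c • (y - a))) :=
  hf.comp (by fun_prop)

lemma lap_sub (hf : ContDiff ℝ ∞ f) (hg : ContDiff ℝ ∞ g) (x : Space) :
    lap (fun y => f y - g y) x = lap f x - lap g x := by
  unfold lap
  rw [← Finset.sum_sub_distrib]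
  refine Finset.sum_congr rfl fun i _ => ?_
  rw [show pd i (fun y => f y - g y) = fun y => pd i f y - pd i g y from
    funext fun y => pd_sub hf hg i y, pd_sub (contDiff_pd hf i) (contDiff_pd hg i)]

lemma lap_const_mul (c : ℝ) (hf : ContDiff ℝ ∞ f) (x : Space) :
    lap (fun y => c * f y) x = c * lap f x := by
  unfold lap
  rw [Finset.mul_sum]
  refine Finset.sum_congr rfl fun i _ => ?_
  rw [show pd i (fun y => c * f y) = fun y => c * pd i f y from
    funext fun y => pd_const_mul c hf i y, pd_const_mul c (contDiff_pd hf i)]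

lemma lap_comp_affine (hf : ContDiff ℝ ∞ f) (c : ℝ) (a : Space) (x : Space) :
    lap (fun y => f (c • (y - a))) x = c ^ 2 * lap f (c • (x - a)) := by
  unfold lap
  rw [Finset.mul_sum]
  refine Finset.sum_congr rfl fun i _ => ?_
  rw [show pd i (fun y => f (c • (y - a))) = fun y => c * pd i f (c • (y - a)) from
    funext fun y => pd_comp_affine hf c a i y,
    pd_const_mul c (contDiff_comp_affine (contDiff_pd hf i) c a),
    pd_comp_affine (contDiff_pd hf i)]
  ring

lemma pd_lap (hf : ContDiff ℝ ∞ f) (i : Fin 3) (x : Space) : pd i (lap f) x = lap (pd i f) x := by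
  change pd i (fun y => ∑ j, pd j (pd j f) y) x = _
  rw [pd_sum _ fun j => contDiff_pd (contDiff_pd hf j) j]
  refine Finset.sum_congr rfl fun j _ => ?_
  rw [pd_comm (contDiff_pd hf j), show pd i (pd j f) = pd j (pd i f) from
    funext fun y => pd_comm hf i j y]

end smooth

lemma gradient_apply (ψ : Space → ℝ) (x : Space) (i : Fin 3) : gradient ψ x i = pd i ψ x := by
  rw [← inner_unitVec, real_inner_comm]
  simp [gradient, pd]

lemma inner_gradient (v : Space) (ψ : Space → ℝ) (x : Space) :
    ⟪v, gradient ψ x⟫_ℝ = ∑ i, v i * pd i ψ x := by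
  rw [inner_eq_sum]
  simp only [gradient_apply]

lemma contDiff_coord {φ : Space → Space} (hφ : ContDiff ℝ ∞ φ) (j : Fin 3) :
    ContDiff ℝ ∞ (fun x => φ x j) :=
  contDiff_euclidean.1 hφ j

lemma hasCompactSupport_coord {φ : Space → Space} (hφ : HasCompactSupport φ) (j : Fin 3) :
    HasCompactSupport (fun x => φ x j) :=
  hφ.comp_left (g := fun v : Space => v j) rfl

lemma fderiv_coord {φ : Space → Space} (hφ : ContDiff ℝ ∞ φ) (x v : Space) (j : Fin 3) :
    (fderiv ℝ φ x v) j = fderiv ℝ (fun y => φ y j) x v := by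
  have h := (hφ.differentiable (by simp) x).hasFDerivAt
  have := ((EuclideanSpace.proj j : Space →L[ℝ] ℝ).hasFDerivAt.comp x h).fderiv
  simp only [Function.comp_def, EuclideanSpace.coe_proj] at this
  rw [this]
  simp

lemma divergence_eq {φ : Space → Space} (hφ : ContDiff ℝ ∞ φ) (x : Space) :
    divergence φ x = ∑ i, pd i (fun y => φ y i) x := by
  unfold divergence
  exact Finset.sum_congr rfl fun i _ => fderiv_coord hφ x _ i

lemma laplacian_eq_lap {f : Space → ℝ} (hf : ContDiff ℝ ∞ f) (x : Space) :
    (Laplacian.laplacian f : Space → ℝ) x = lap f x := by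
  rw [InnerProductSpace.laplacian_eq_iteratedFDeriv_orthonormalBasis f
    (EuclideanSpace.basisFun (Fin 3) ℝ)]
  simp only [lap]
  refine Finset.sum_congr rfl fun i _ => ?_
  rw [iteratedFDeriv_two_apply]
  have hd : DifferentiableAt ℝ (fderiv ℝ f) x :=
    ((hf.fderiv_right (m := ∞) (by simp)).differentiable (by simp)) x
  have := (hd.hasFDerivAt.clm_apply (hasFDerivAt_const (unitVec i) x)).fderiv
  unfold pd
  rw [this]
  simp [unitVec]

lemma laplacian_coord {φ : Space → Space} (hφ : ContDiff ℝ ∞ φ) (x : Space) (j : Fin 3) :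
    (Laplacian.laplacian φ : Space → Space) x j = lap (fun y => φ y j) x := by
  have h := ContDiffAt.laplacian_CLM_comp_left (f := φ) (x := x)
    (l := (EuclideanSpace.proj j : Space →L[ℝ] ℝ))
    ((hφ.of_le ENat.LEInfty.out).contDiffAt)
  rw [← laplacian_eq_lap (contDiff_coord hφ j)]
  simpa [Function.comp_def] using h.symm

/-! ### The flow of a bounded Lipschitz vector field -/

section flow

variable {E : Type*} [NormedAddCommGroup E] [NormedSpace ℝ E]

/-- Two integral curves of a Lipschitz field diverge at most exponentially, in both time
directions. -/
lemma dist_integralCurve_le {v : E → E} {K : ℝ≥0} (hv : LipschitzWith K v) {f g : ℝ → E}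
    (hf : ∀ t, HasDerivAt f (v (f t)) t) (hg : ∀ t, HasDerivAt g (v (g t)) t) (t : ℝ) :
    dist (f t) (g t) ≤ dist (f 0) (g 0) * Real.exp (K * |t|) := by
  rcases le_total 0 t with ht | ht
  · have := dist_le_of_trajectories_ODE (v := fun _ => v) (K := K) (f := f) (g := g) (a := 0)
      (b := t) (δ := dist (f 0) (g 0)) (fun _ => hv)
      (fun s _ => (hf s).continuousAt.continuousWithinAt) (fun s _ => (hf s).hasDerivWithinAt)
      (fun s _ => (hg s).continuousAt.continuousWithinAt) (fun s _ => (hg s).hasDerivWithinAt)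
      le_rfl t ⟨ht, le_rfl⟩
    simpa [abs_of_nonneg ht] using this
  · have hneg : ∀ {f : ℝ → E}, (∀ t, HasDerivAt f (v (f t)) t) →
        ∀ s, HasDerivAt (fun s => f (-s)) (-v (f (-s))) s := by
      intro f hf s
      simpa [Function.comp_def] using (hf (-s)).scomp s (hasDerivAt_neg s)
    have hv' : LipschitzWith K (fun x => -v x) := hv.neg
    have := dist_le_of_trajectories_ODE (v := fun _ x => -v x) (K := K) (f := fun s => f (-s))
      (g := fun s => g (-s)) (a := 0)
      (b := -t) (δ := dist (f 0) (g 0)) (fun _ => hv')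
      (fun s _ => (hneg hf s).continuousAt.continuousWithinAt)
      (fun s _ => (hneg hf s).hasDerivWithinAt)
      (fun s _ => (hneg hg s).continuousAt.continuousWithinAt)
      (fun s _ => (hneg hg s).hasDerivWithinAt)
      (by simp) (-t) ⟨by linarith, le_rfl⟩
    simpa [abs_of_nonpos ht] using this

/-- A bounded Lipschitz vector field on a Banach space has a global integral curve through every
point. -/
lemma exists_integralCurve [CompleteSpace E] {v : E → E} {K : ℝ≥0} (hv : LipschitzWith K v)
    {C : ℝ≥0} (hC : ∀ x, ‖v x‖ ≤ C) (x : E) :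
    ∃ α : ℝ → E, α 0 = x ∧ ∀ t, HasDerivAt α (v (α t)) t := by
  have hloc : ∀ n : ℕ, ∃ α : ℝ → E, α 0 = x ∧
      ∀ t ∈ Ioo (-(n : ℝ)) n, HasDerivAt α (v (α t)) t := by
    intro n
    have h0 : (0 : ℝ) ∈ Icc (-(n : ℝ)) n := by constructor <;> simp
    have hpl : IsPicardLindelof (fun _ => v) (⟨0, h0⟩ : Icc (-(n : ℝ)) n) x (C * n) 0 C K :=
      { lipschitzOnWith := fun _ _ => hv.lipschitzOnWith
        continuousOn := fun _ _ => continuousOn_const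
        norm_le := fun _ _ y _ => hC y
        mul_max_le := by simp }
    obtain ⟨α, h1, h2⟩ := hpl.exists_eq_forall_mem_Icc_hasDerivWithinAt₀
    exact ⟨α, h1, fun t ht => (h2 t (Ioo_subset_Icc_self ht)).hasDerivAt (Icc_mem_nhds ht.1 ht.2)⟩
  choose α h0 hα using hloc
  have hagree : ∀ m n : ℕ, 0 < m → m ≤ n → EqOn (α m) (α n) (Ioo (-(m : ℝ)) m) := by
    intro m n hm hmn
    have hm' : (0 : ℝ) < m := by exact_mod_cast hm
    have hmn' : (m : ℝ) ≤ n := by exact_mod_cast hmn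
    refine ODE_solution_unique_of_mem_Ioo (v := fun _ => v) (s := fun _ => univ) (K := K)
      (t₀ := 0) (fun _ _ => hv.lipschitzOnWith) ⟨by linarith, hm'⟩
      (fun t ht => ⟨hα m t ht, mem_univ _⟩)
      (fun t ht => ⟨hα n t ⟨by linarith [ht.1], by linarith [ht.2]⟩, mem_univ _⟩)
      ((h0 m).trans (h0 n).symm)
  -- on `(-n, n)` the glued curve coincides with `α n`
  have hglue : ∀ n : ℕ, ∀ s ∈ Ioo (-(n : ℝ)) n, α (⌊|s|⌋₊ + 1) s = α n s := by
    intro n s hs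
    have hlt : |s| < n := abs_lt.2 hs
    have hmem : s ∈ Ioo (-((⌊|s|⌋₊ + 1 : ℕ) : ℝ)) ((⌊|s|⌋₊ + 1 : ℕ) : ℝ) := by
      have := abs_lt.1 (Nat.lt_floor_add_one |s|)
      push_cast
      exact this
    refine hagree _ n (Nat.succ_pos _) ?_ hmem
    exact Nat.succ_le_of_lt ((Nat.floor_lt (abs_nonneg s)).2 hlt)
  refine ⟨fun s => α (⌊|s|⌋₊ + 1) s, by simp [h0], fun t => ?_⟩
  obtain ⟨n, hn⟩ := exists_nat_gt |t|
  have ht : t ∈ Ioo (-(n : ℝ)) n := abs_lt.1 hn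
  have hev : (fun s => α (⌊|s|⌋₊ + 1) s) =ᶠ[𝓝 t] α n := by
    filter_upwards [Ioo_mem_nhds ht.1 ht.2] with s hs using hglue n s hs
  have := (hα n t ht).congr_of_eventuallyEq hev
  simpa only [hglue n t ht] using this

/-- `Y` is the flow of the autonomous vector field `v`. -/
structure IsFlowOf (v : E → E) (Y : ℝ → E → E) : Prop where
  zero : ∀ x, Y 0 x = x
  deriv : ∀ t x, HasDerivAt (fun s => Y s x) (v (Y t x)) t

lemma exists_isFlowOf [CompleteSpace E] {v : E → E} {K : ℝ≥0} (hv : LipschitzWith K v)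
    {C : ℝ≥0} (hC : ∀ x, ‖v x‖ ≤ C) : ∃ Y, IsFlowOf v Y := by
  choose α h0 hα using exists_integralCurve hv hC
  exact ⟨fun t x => α x t, h0, fun t x => hα x t⟩

namespace IsFlowOf

variable {v : E → E} {Y : ℝ → E → E}

lemma lipschitzWith (hY : IsFlowOf v Y) {K : ℝ≥0} (hv : LipschitzWith K v) (t : ℝ) :
    LipschitzWith (Real.exp (K * |t|)).toNNReal (Y t) := by
  refine LipschitzWith.of_dist_le_mul fun x y => ?_
  have := dist_integralCurve_le hv (fun t => hY.deriv t x) (fun t => hY.deriv t y) t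
  rw [hY.zero, hY.zero] at this
  rw [Real.coe_toNNReal _ (Real.exp_pos _).le, mul_comm]
  exact this

lemma add (hY : IsFlowOf v Y) {K : ℝ≥0} (hv : LipschitzWith K v) (s t : ℝ) (x : E) :
    Y (s + t) x = Y s (Y t x) := by
  have h1 : ∀ r, HasDerivAt (fun r => Y (r + t) x) (v (Y (r + t) x)) r := fun r =>
    (hY.deriv (r + t) x).comp_add_const r t
  have := dist_integralCurve_le hv h1 (fun r => hY.deriv r (Y t x)) s
  simp only [zero_add, hY.zero, dist_self, zero_mul] at this
  exact dist_le_zero.1 this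

lemma neg_cancel (hY : IsFlowOf v Y) {K : ℝ≥0} (hv : LipschitzWith K v) (t : ℝ) (x : E) :
    Y (-t) (Y t x) = x := by
  rw [← hY.add hv, neg_add_cancel, hY.zero]

lemma dist_le (hY : IsFlowOf v Y) {C : ℝ≥0} (hC : ∀ x, ‖v x‖ ≤ C) (s t : ℝ) (x : E) :
    dist (Y s x) (Y t x) ≤ C * |s - t| := by
  have := Convex.norm_image_sub_le_of_norm_hasDerivWithin_le (f := fun s => Y s x)
    (f' := fun s => v (Y s x)) (s := univ) (x := t) (y := s) (C := C)
    (fun s _ => (hY.deriv s x).hasDerivWithinAt) (fun s _ => hC _) convex_univ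
    (mem_univ _) (mem_univ _)
  rwa [dist_eq_norm]

end IsFlowOf

end flow

section volume

/-- A continuous proper map under which the integrals of Lipschitz functions with compact support
are invariant preserves Lebesgue measure. -/
lemma measurePreserving_of_integral_comp_eq {T : Space → Space} (hT : Continuous T)
    (hproper : ∀ K : Set Space, IsCompact K → IsCompact (T ⁻¹' K))
    (h : ∀ (L : ℝ≥0) (φ : Space → ℝ), LipschitzWith L φ → HasCompactSupport φ →
      ∫ x, φ (T x) = ∫ x, φ x) : MeasurePreserving T volume volume := by
  refine ⟨hT.measurable, ?_⟩
  have hgen : (inferInstance : MeasurableSpace Space) =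
      MeasurableSpace.generateFrom {K : Set Space | IsCompact K} := by
    refine le_antisymm ?_ (MeasurableSpace.generateFrom_le fun K hK => hK.measurableSet)
    rw [BorelSpace.measurable_eq (α := Space), borel_eq_generateFrom_isClosed]
    refine MeasurableSpace.generateFrom_le fun F hF => ?_
    have : F = ⋃ n : ℕ, F ∩ closedBall 0 n := by
      rw [← inter_iUnion, iUnion_closedBall_nat, inter_univ]
    rw [this]
    exact MeasurableSet.iUnion fun n => MeasurableSpace.measurableSet_generateFrom
      ((isCompact_closedBall _ _).inter_left hF)
  refine Measure.ext_of_generateFrom_of_iUnion {K : Set Space | IsCompact K}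
    (fun n : ℕ => closedBall 0 n) hgen
    (fun K hK L hL _ => hK.inter hL) (iUnion_closedBall_nat _) (fun n => isCompact_closedBall _ _)
    ?_ ?_
  · intro n
    rw [Measure.map_apply hT.measurable measurableSet_closedBall]
    exact (hproper _ (isCompact_closedBall _ _)).measure_lt_top.ne
  intro K hK
  have hK : IsCompact K := hK
  rw [Measure.map_apply hT.measurable hK.measurableSet]
  -- approximate the indicator of `K` by thickened indicators
  let δ : ℕ → ℝ := fun n => 1 / ((n : ℝ) + 1)
  have hδ : ∀ n, 0 < δ n := fun n => by positivity
  have hδ1 : ∀ n, δ n ≤ 1 := fun n => by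
    rw [div_le_one (by positivity)]
    linarith [n.cast_nonneg (α := ℝ)]
  let f : ℕ → Space → ℝ := fun n x => (thickenedIndicator (hδ n) K x : ℝ)
  have hflip : ∀ n, LipschitzWith (δ n).toNNReal⁻¹ (f n) := fun n =>
    lipschitzWith_thickenedIndicator (hδ n) K
  have hout : ∀ n x, x ∉ cthickening 1 K → f n x = 0 := by
    intro n x hx
    have : x ∉ thickening (δ n) K := fun h' =>
      hx (cthickening_mono (hδ1 n) K (thickening_subset_cthickening _ _ h'))
    simp only [f]
    rw [thickenedIndicator_zero (hδ n) K this]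
    rfl
  have hcth : IsCompact (cthickening 1 K) := hK.cthickening
  have hfsupp : ∀ n, HasCompactSupport (f n) := fun n =>
    HasCompactSupport.intro hcth (hout n)
  have hbound : ∀ n x, ‖f n x‖ ≤ (cthickening 1 K).indicator (fun _ => (1 : ℝ)) x := by
    intro n x
    by_cases hx : x ∈ cthickening 1 K
    · rw [indicator_of_mem hx, Real.norm_of_nonneg (NNReal.coe_nonneg _)]
      exact_mod_cast thickenedIndicator_le_one (hδ n) K x
    · rw [hout n x hx]
      simp [indicator_of_notMem hx]
  have hlim : ∀ x, Tendsto (fun n => f n x) atTop (𝓝 (K.indicator (fun _ => (1 : ℝ)) x)) := by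
    intro x
    have h1 := thickenedIndicator_tendsto_indicator_closure hδ
      tendsto_one_div_add_atTop_nhds_zero_nat K
    have h2 := (tendsto_pi_nhds.1 h1 x)
    rw [hK.isClosed.closure_eq] at h2
    have h3 := (NNReal.continuous_coe.tendsto _).comp h2
    have h4 : ((K.indicator (fun _ => (1 : ℝ≥0)) x : ℝ≥0) : ℝ) = K.indicator (fun _ => 1) x := by
      by_cases hx : x ∈ K <;> simp [hx]
    rw [h4] at h3
    exact h3
  have hint : ∀ {A : Set Space}, IsCompact A →
      Integrable (A.indicator (fun _ => (1 : ℝ))) := fun hA =>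
    (integrable_indicator_iff hA.measurableSet).2
      (integrableOn_const hA.measure_lt_top.ne)
  have hpre : ∀ A : Set Space, (fun x => A.indicator (fun _ => (1 : ℝ)) (T x)) =
      (T ⁻¹' A).indicator (fun _ => (1 : ℝ)) := fun A => rfl
  have l1 : Tendsto (fun n => ∫ x, f n x) atTop (𝓝 (∫ x, K.indicator (fun _ => (1 : ℝ)) x)) :=
    tendsto_integral_of_dominated_convergence _
      (fun n => (hflip n).continuous.aestronglyMeasurable) (hint hcth)
      (fun n => Eventually.of_forall (hbound n)) (Eventually.of_forall hlim)
  have l2 : Tendsto (fun n => ∫ x, f n (T x)) atTop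
      (𝓝 (∫ x, K.indicator (fun _ => (1 : ℝ)) (T x))) :=
    tendsto_integral_of_dominated_convergence
      (fun x => (cthickening 1 K).indicator (fun _ => (1 : ℝ)) (T x))
      (fun n => ((hflip n).continuous.comp hT).aestronglyMeasurable)
      (by rw [hpre]; exact hint (hproper _ hcth))
      (fun n => Eventually.of_forall fun x => hbound n (T x))
      (Eventually.of_forall fun x => hlim (T x))
  have heq := tendsto_nhds_unique (l2.congr fun n => h _ (f n) (hflip n) (hfsupp n)) l1
  rw [hpre, integral_indicator_const _ (hproper _ hK).measurableSet,
    integral_indicator_const _ hK.measurableSet] at heq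
  simp only [smul_eq_mul, mul_one] at heq
  exact (measureReal_eq_measureReal_iff (hproper _ hK).measure_lt_top.ne
    hK.measure_lt_top.ne).1 heq

/-- Liouville's theorem: the flow of a bounded Lipschitz field which is divergence free, in the
sense that it is orthogonal to the gradients of Lipschitz functions with compact support, preserves
Lebesgue measure. Since `φ ∘ Y t` is again Lipschitz with compact support, the derivative of
`t ↦ ∫ φ ∘ Y t` at any time is of the form `∫ Dg v`, and vanishes. -/
lemma IsFlowOf.measurePreserving {v : Space → Space} {Y : ℝ → Space → Space} (hY : IsFlowOf v Y)
    {K C : ℝ≥0} (hv : LipschitzWith K v) (hC : ∀ x, ‖v x‖ ≤ C)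
    (hdiv : ∀ (L : ℝ≥0) (g : Space → ℝ), LipschitzWith L g → HasCompactSupport g →
      ∫ x, fderiv ℝ g x (v x) = 0) (t : ℝ) : MeasurePreserving (Y t) volume volume := by
  have hcont : ∀ t, Continuous (Y t) := fun t => (hY.lipschitzWith hv t).continuous
  have hproper : ∀ t, ∀ A : Set Space, IsCompact A → IsCompact (Y t ⁻¹' A) := by
    intro t A hA
    have : Y t ⁻¹' A = Y (-t) '' A := by
      ext x
      constructor
      · intro hx
        exact ⟨Y t x, hx, hY.neg_cancel hv t x⟩
      · rintro ⟨y, hy, rfl⟩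
        have := hY.neg_cancel hv (-t) y
        rw [neg_neg] at this
        simpa [this] using hy
    rw [this]
    exact hA.image (hcont _)
  refine measurePreserving_of_integral_comp_eq (hcont t) (hproper t) fun L φ hφ hφc => ?_
  -- the derivative at time `0`
  have key : ∀ (L : ℝ≥0) (g : Space → ℝ), LipschitzWith L g → HasCompactSupport g →
      HasDerivAt (fun h => ∫ x, g (Y h x)) 0 0 := by
    intro L g hg hgc
    let A : Set Space := cthickening (C * 1) (tsupport g)
    have hA : IsCompact A := hgc.cthickening
    have hout : ∀ x ∉ A, ∀ h ∈ ball (0 : ℝ) 1, g (Y h x) = 0 := by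
      intro x hx h hh
      by_contra hne
      refine hx ?_
      refine mem_cthickening_of_dist_le x (Y h x) _ _ (subset_tsupport g hne) ?_
      have h1 := hY.dist_le hC 0 h x
      rw [hY.zero] at h1
      refine h1.trans ?_
      gcongr
      rw [mem_ball_zero_iff, Real.norm_eq_abs] at hh
      rw [zero_sub, abs_neg]
      exact hh.le
    have := hasDerivAt_integral_of_dominated_loc_of_lip (μ := (volume : Measure Space))
      (F := fun h x => g (Y h x)) (F' := fun x => fderiv ℝ g x (v x)) (x₀ := (0 : ℝ))
      (bound := A.indicator fun _ => (L : ℝ) * C) (ball_mem_nhds 0 one_pos)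
      (Eventually.of_forall fun h => (hg.continuous.comp (hcont h)).aestronglyMeasurable)
      (by
        simp only [hY.zero]
        exact hg.continuous.integrable_of_hasCompactSupport hgc)
      (isBoundedBilinearMap_apply.continuous.comp_aestronglyMeasurable
        ((measurable_fderiv ℝ g).aestronglyMeasurable.prodMk
          hv.continuous.aestronglyMeasurable))
      (Eventually.of_forall fun x => by
        by_cases hx : x ∈ A
        · refine LipschitzOnWith.of_dist_le_mul fun s _ r _ => ?_
          rw [indicator_of_mem hx]
          rw [Real.coe_nnabs, abs_of_nonneg (by positivity), mul_assoc]
          refine (hg.dist_le_mul _ _).trans ?_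
          gcongr
          exact hY.dist_le hC s r x
        · refine LipschitzOnWith.of_dist_le_mul fun s hs r hr => ?_
          simp only [hout x hx s hs, hout x hx r hr, dist_self]
          positivity)
      ((integrable_indicator_iff hA.measurableSet).2 (integrableOn_const hA.measure_lt_top.ne))
      (by
        filter_upwards [hg.ae_differentiableAt] with x hx
        have h1 := hY.deriv 0 x
        rw [hY.zero] at h1
        have h2 : HasFDerivAt g (fderiv ℝ g x) (Y 0 x) := by
          rw [hY.zero]
          exact hx.hasFDerivAt
        exact h2.comp_hasDerivAt 0 h1)
    have h2 := this.2
    rwa [hdiv L g hg hgc] at h2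
  have hder : ∀ r, HasDerivAt (fun r => ∫ x, φ (Y r x)) 0 r := by
    intro r
    have h1 := key _ (φ ∘ Y r) (hφ.comp (hY.lipschitzWith hv r))
      (HasCompactSupport.intro (hproper r _ hφc) fun x hx =>
        image_eq_zero_of_notMem_tsupport (f := φ) hx)
    have h2 : (fun h => ∫ x, (φ ∘ Y r) (Y h x)) = fun h => ∫ x, φ (Y (h + r) x) := by
      ext h
      simp only [Function.comp_apply]
      refine integral_congr_ae (Eventually.of_forall fun x => ?_)
      simp only
      rw [← hY.add hv, add_comm]
    rw [h2] at h1
    have h3 := HasDerivAt.comp_sub_const r r (f := fun h => ∫ x, φ (Y (h + r) x)) (f' := 0)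
      (by rwa [sub_self])
    simpa using h3
  have := is_const_of_deriv_eq_zero (fun r => (hder r).differentiableAt)
    (fun r => (hder r).deriv) t 0
  simpa [hY.zero] using this

end volume

lemma hasLineDerivAt_coord (x : Space) (i j : Fin 3) :
    HasLineDerivAt ℝ (fun y : Space => y i) (if i = j then 1 else 0) x (unitVec j) := by
  have := ((hasDerivAt_id (0 : ℝ)).mul_const (unitVec j i)).const_add (x i)
  rw [unitVec_apply, one_mul] at this
  unfold HasLineDerivAt
  simpa [unitVec_apply] using this

lemma hasLineDerivAt_inv_norm {x : Space} (hx : x ≠ 0) (j : Fin 3) :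
    HasLineDerivAt ℝ (fun y : Space => ‖y‖⁻¹) (-(x j * ‖x‖⁻¹ ^ 3)) x (unitVec j) := by
  have hr : 0 < ‖x‖ := norm_pos_iff.2 hx
  have hline : HasDerivAt (fun t : ℝ => x + t • unitVec j) (unitVec j) 0 := by
    simpa using ((hasDerivAt_id (0 : ℝ)).smul_const (unitVec j)).const_add x
  have h1 := (hline.norm_sq).sqrt (by simpa using hr.ne')
  simp only [zero_smul, add_zero, Real.sqrt_sq (norm_nonneg _)] at h1
  have h2 := h1.inv (by simpa using hr.ne')
  simp only [zero_smul, add_zero] at h2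
  have h3 : ⟪x, unitVec j⟫_ℝ = x j := by rw [real_inner_comm, inner_unitVec]
  rw [h3] at h2
  refine HasDerivAt.congr_deriv h2 ?_
  field_simp

/-! ### Integration by parts against Lipschitz functions -/

/-- Bounded Lipschitz functions. -/
structure IsBddLip (f : Space → ℝ) : Prop where
  lipschitz : ∃ K : ℝ≥0, LipschitzWith K f
  bounded : ∃ C : ℝ, ∀ x, |f x| ≤ C

namespace IsBddLip

variable {f g : Space → ℝ}

lemma const (c : ℝ) : IsBddLip fun _ => c :=
  ⟨⟨0, LipschitzWith.const c⟩, |c|, fun _ => le_rfl⟩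

lemma add (hf : IsBddLip f) (hg : IsBddLip g) : IsBddLip fun x => f x + g x := by
  obtain ⟨⟨K, hK⟩, C, hC⟩ := hf
  obtain ⟨⟨L, hL⟩, D, hD⟩ := hg
  exact ⟨⟨K + L, hK.add hL⟩, C + D, fun x => (abs_add_le _ _).trans (add_le_add (hC x) (hD x))⟩

lemma mul (hf : IsBddLip f) (hg : IsBddLip g) : IsBddLip fun x => f x * g x := by
  obtain ⟨⟨K, hK⟩, C, hC⟩ := hf
  obtain ⟨⟨L, hL⟩, D, hD⟩ := hg
  have hC0 : 0 ≤ C := (abs_nonneg _).trans (hC 0)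
  have hD0 : 0 ≤ D := (abs_nonneg _).trans (hD 0)
  refine ⟨⟨(C * L + D * K).toNNReal, LipschitzWith.of_dist_le_mul fun x y => ?_⟩, C * D,
    fun x => by rw [abs_mul]; exact mul_le_mul (hC x) (hD x) (abs_nonneg _) hC0⟩
  rw [Real.coe_toNNReal _ (by positivity), Real.dist_eq]
  have h1 := hK.dist_le_mul x y
  have h2 := hL.dist_le_mul x y
  rw [Real.dist_eq] at h1 h2
  calc |f x * g x - f y * g y| = |f x * (g x - g y) + g y * (f x - f y)| := by congr 1; ring
    _ ≤ |f x| * |g x - g y| + |g y| * |f x - f y| := by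
        rw [← abs_mul, ← abs_mul]; exact abs_add_le _ _
    _ ≤ C * (L * dist x y) + D * (K * dist x y) := by
        gcongr
        exacts [hC x, hD y]
    _ = (C * L + D * K) * dist x y := by ring

lemma const_mul (c : ℝ) (hf : IsBddLip f) : IsBddLip fun x => c * f x := (const c).mul hf

lemma sub (hf : IsBddLip f) (hg : IsBddLip g) : IsBddLip fun x => f x - g x := by
  simpa [sub_eq_add_neg] using hf.add (hg.const_mul (-1))

lemma pow (hf : IsBddLip f) (n : ℕ) : IsBddLip fun x => f x ^ n := by
  induction n with
  | zero => simpa using const 1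
  | succ n ih => simpa [pow_succ] using ih.mul hf

lemma continuous (hf : IsBddLip f) : Continuous f := hf.lipschitz.choose_spec.continuous

end IsBddLip

lemma integrable_pd_mul {f g : Space → ℝ} {L : ℝ≥0} (hf : Continuous f) (hg : LipschitzWith L g)
    (hgc : HasCompactSupport g) (i : Fin 3) : Integrable fun x => f x * pd i g x := by
  have hm : Measurable (pd i g) := measurable_fderiv_apply_const ℝ g (unitVec i)
  have hb : ∀ x, ‖pd i g x‖ ≤ L := fun x => by
    refine (ContinuousLinearMap.le_opNorm _ _).trans ?_
    rw [norm_unitVec, mul_one]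
    exact norm_fderiv_le_of_lipschitz ℝ hg
  have hs : ∀ x ∉ tsupport g, pd i g x = 0 := fun x hx => by
    have : x ∉ tsupport (pd i g) := fun h => hx (tsupport_fderiv_apply_subset ℝ (unitVec i) h)
    exact image_eq_zero_of_notMem_tsupport this
  have hfi : IntegrableOn f (tsupport g) := hf.continuousOn.integrableOn_compact hgc
  have h1 : IntegrableOn (fun x => f x * pd i g x) (tsupport g) :=
    hfi.mul_bdd hm.aestronglyMeasurable (Eventually.of_forall hb)
  refine (integrableOn_iff_integrable_of_support_subset ?_).1 h1
  intro x hx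
  by_contra h
  exact hx (by simp [hs x h])

lemma integrable_mul_of_compactSupport {f g : Space → ℝ} (hf : Continuous f) (hg : Continuous g)
    (hgc : HasCompactSupport g) : Integrable fun x => f x * g x :=
  (hf.mul hg).integrable_of_hasCompactSupport hgc.mul_left

lemma lipschitz_of_smooth {g : Space → ℝ} (hg : ContDiff ℝ ∞ g) (hgc : HasCompactSupport g) :
    ∃ L : ℝ≥0, LipschitzWith L g :=
  ContDiff.lipschitzWith_of_hasCompactSupport hgc hg (by simp)

/-- Integration by parts of a partial derivative, for Lipschitz functions. -/
lemma integral_deriv_mul_eq {f f' g : Space → ℝ} (hf : IsBddLip f) {j : Fin 3}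
    (hf' : ∀ᵐ x : Space, HasLineDerivAt ℝ f (f' x) x (unitVec j)) {L : ℝ≥0}
    (hg : LipschitzWith L g) (hgc : HasCompactSupport g) :
    ∫ x, f x * pd j g x = -∫ x, f' x * g x := by
  obtain ⟨K, hK⟩ := hf.lipschitz
  have h := hK.integral_lineDeriv_mul_eq (μ := volume) hg hgc (unitVec j)
  have h1 : ∫ x, lineDeriv ℝ f x (unitVec j) * g x = ∫ x, f' x * g x := by
    refine integral_congr_ae ?_
    filter_upwards [hf'] with x hx
    rw [hx.lineDeriv]
  have h2 : ∫ x, lineDeriv ℝ g x (-unitVec j) * f x = -∫ x, f x * pd j g x := by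
    rw [← integral_neg]
    refine integral_congr_ae ?_
    filter_upwards [hg.ae_differentiableAt] with x hx
    rw [hx.lineDeriv_eq_fderiv, pd, map_neg]
    ring
  rw [h1, h2] at h
  linarith

lemma integrable_deriv_mul {f f' g : Space → ℝ} (hf : IsBddLip f) {j : Fin 3}
    (hf' : ∀ᵐ x : Space, HasLineDerivAt ℝ f (f' x) x (unitVec j)) {L : ℝ≥0}
    (hg : LipschitzWith L g) (hgc : HasCompactSupport g) :
    Integrable fun x => f' x * g x := by
  obtain ⟨K, hK⟩ := hf.lipschitz
  have h1 : Integrable fun x => lineDeriv ℝ f x (unitVec j) * g x := by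
    refine (hg.continuous.integrable_of_hasCompactSupport hgc).bdd_mul (c := K * ‖unitVec j‖)
      (aestronglyMeasurable_lineDeriv hK.continuous _) ?_
    exact Eventually.of_forall fun x => norm_lineDeriv_le_of_lipschitz ℝ hK
  refine h1.congr ?_
  filter_upwards [hf'] with x hx
  rw [hx.lineDeriv]

/-! ### The velocity generated by a ball -/

/-- The factor `s = R / max(|x|, R)` by which the projection to the ball of radius `R` contracts. -/
noncomputable def shrink (R : ℝ) (x : Space) : ℝ := R / max ‖x‖ R

/-- The `i`-th coordinate of the projection of `x` to the ball of radius `R`. -/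
noncomputable def proj (R : ℝ) (i : Fin 3) (x : Space) : ℝ := shrink R x * x i

/-- The squared norm `min(|x|, R) ^ 2` of the projection of `x` to the ball of radius `R`. -/
noncomputable def projSq (R : ℝ) (x : Space) : ℝ := proj R 0 x ^ 2 + proj R 1 x ^ 2 + proj R 2 x ^ 2

lemma projSq_eq (R : ℝ) (x : Space) : projSq R x = shrink R x ^ 2 * ‖x‖ ^ 2 := by
  rw [norm_sq_eq_sum]
  simp only [projSq, proj]
  ring

section ball

variable {R : ℝ}

lemma shrink_of_le (hR : 0 < R) {x : Space} (hx : ‖x‖ ≤ R) : shrink R x = 1 := by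
  rw [shrink, max_eq_right hx, div_self hR.ne']

lemma shrink_of_ge {x : Space} (hx : R ≤ ‖x‖) : shrink R x = R / ‖x‖ := by
  rw [shrink, max_eq_left hx]

lemma shrink_pos (hR : 0 < R) (x : Space) : 0 < shrink R x :=
  div_pos hR (lt_max_of_lt_right hR)

lemma shrink_le_one (hR : 0 < R) (x : Space) : shrink R x ≤ 1 :=
  (div_le_one (lt_max_of_lt_right hR)).2 (le_max_right _ _)

lemma shrink_mul_norm_le (hR : 0 < R) (x : Space) : shrink R x * ‖x‖ ≤ R := by
  rw [shrink, div_mul_eq_mul_div, div_le_iff₀ (lt_max_of_lt_right hR)]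
  gcongr
  exact le_max_left _ _

lemma abs_shrink_sub_le (hR : 0 < R) (x y : Space) :
    |shrink R x - shrink R y| * max ‖y‖ R ≤ dist x y := by
  have hx : 0 < max ‖x‖ R := lt_max_of_lt_right hR
  have hy : 0 < max ‖y‖ R := lt_max_of_lt_right hR
  have h1 : shrink R x - shrink R y = R * (max ‖y‖ R - max ‖x‖ R) / (max ‖x‖ R * max ‖y‖ R) := by
    unfold shrink
    field_simp
  have h2 : |max ‖y‖ R - max ‖x‖ R| ≤ dist x y := by
    refine (abs_max_sub_max_le_abs _ _ _).trans ?_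
    rw [dist_comm, dist_eq_norm]
    exact abs_norm_sub_norm_le _ _
  rw [h1, abs_div, abs_mul, abs_of_pos hR, abs_of_pos (mul_pos hx hy), div_mul_eq_mul_div,
    div_le_iff₀ (mul_pos hx hy)]
  calc R * |max ‖y‖ R - max ‖x‖ R| * max ‖y‖ R ≤ max ‖x‖ R * dist x y * max ‖y‖ R := by
        gcongr
        exact le_max_right _ _
    _ = dist x y * (max ‖x‖ R * max ‖y‖ R) := by ring

lemma isBddLip_shrink (hR : 0 < R) : IsBddLip (shrink R) := by
  refine ⟨⟨(1 / R).toNNReal, LipschitzWith.of_dist_le_mul fun x y => ?_⟩, 1, fun x => ?_⟩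
  · rw [Real.coe_toNNReal _ (by positivity), Real.dist_eq, div_mul_eq_mul_div, one_mul,
      le_div_iff₀ hR]
    refine le_trans ?_ (abs_shrink_sub_le hR x y)
    gcongr
    exact le_max_right _ _
  · rw [abs_of_pos (shrink_pos hR x)]
    exact shrink_le_one hR x

lemma abs_proj_le (hR : 0 < R) (i : Fin 3) (x : Space) : |proj R i x| ≤ R := by
  rw [proj, abs_mul, abs_of_pos (shrink_pos hR x)]
  refine le_trans ?_ (shrink_mul_norm_le hR x)
  gcongr
  · exact (shrink_pos hR x).le
  · exact abs_coord_le_norm x i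

lemma isBddLip_proj (hR : 0 < R) (i : Fin 3) : IsBddLip (proj R i) := by
  refine ⟨⟨2, LipschitzWith.of_dist_le_mul fun x y => ?_⟩, R, abs_proj_le hR i⟩
  rw [Real.dist_eq]
  have h1 : proj R i x - proj R i y = shrink R x * (x - y) i + (shrink R x - shrink R y) * y i := by
    simp only [proj, PiLp.sub_apply]
    ring
  have h2 : |shrink R x * (x - y) i| ≤ dist x y := by
    rw [abs_mul, abs_of_pos (shrink_pos hR x), dist_eq_norm, ← one_mul ‖x - y‖]
    exact mul_le_mul (shrink_le_one hR x) (abs_coord_le_norm _ i) (abs_nonneg _) zero_le_one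
  have h3 : |(shrink R x - shrink R y) * y i| ≤ dist x y := by
    rw [abs_mul]
    refine le_trans ?_ (abs_shrink_sub_le hR x y)
    gcongr
    exact (abs_coord_le_norm y i).trans (le_max_left _ _)
  rw [h1]
  refine (abs_add_le _ _).trans ?_
  push_cast
  linarith

lemma isBddLip_projSq (hR : 0 < R) : IsBddLip (projSq R) :=
  (((isBddLip_proj hR 0).pow 2).add ((isBddLip_proj hR 1).pow 2)).add ((isBddLip_proj hR 2).pow 2)

lemma ae_norm_ne (R : ℝ) : ∀ᵐ x : Space, ‖x‖ ≠ R := by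
  have h : volume (sphere (0 : Space) R) = 0 := Measure.addHaar_sphere _ _ _
  rw [ae_iff]
  convert h using 2
  ext x
  simp

/-- Away from the sphere of radius `R`, the contraction factor `s` and the projection to the ball
have the partial derivatives `∂ⱼ s = -τ xⱼ` and `∂ⱼ yᵢ = s δᵢⱼ - τ xᵢ xⱼ`, with `s = 1`, `τ = 0`
inside the sphere and `s = R / |x|`, `τ = R / |x| ^ 3` outside. -/
lemma exists_hasLineDerivAt_proj (hR : 0 < R) {x : Space} (hx : ‖x‖ ≠ R) :
    ∃ τ : ℝ, (∀ j, HasLineDerivAt ℝ (shrink R) (-(τ * x j)) x (unitVec j)) ∧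
      (∀ i j, HasLineDerivAt ℝ (proj R i)
        (shrink R x * (if i = j then 1 else 0) - τ * x i * x j) x (unitVec j)) ∧
      ((shrink R x = 1 ∧ τ = 0 ∧ ‖x‖ < R) ∨
        (τ * R ^ 2 = shrink R x ^ 3 ∧ shrink R x ^ 2 * ‖x‖ ^ 2 = R ^ 2 ∧
          τ * ‖x‖ ^ 2 = shrink R x ∧ R < ‖x‖)) := by
  suffices h : ∃ τ : ℝ, (∀ j, HasLineDerivAt ℝ (shrink R) (-(τ * x j)) x (unitVec j)) ∧
      ((shrink R x = 1 ∧ τ = 0 ∧ ‖x‖ < R) ∨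
        (τ * R ^ 2 = shrink R x ^ 3 ∧ shrink R x ^ 2 * ‖x‖ ^ 2 = R ^ 2 ∧
          τ * ‖x‖ ^ 2 = shrink R x ∧ R < ‖x‖)) by
    obtain ⟨τ, h1, h2⟩ := h
    refine ⟨τ, h1, fun i j => ?_, h2⟩
    have := HasDerivAt.mul (h1 j) (hasLineDerivAt_coord x i j)
    simp only [zero_smul, add_zero] at this
    unfold HasLineDerivAt
    refine HasDerivAt.congr_deriv this ?_
    ring
  rcases lt_or_gt_of_ne hx with hlt | hgt
  · refine ⟨0, fun j => ?_, Or.inl ⟨shrink_of_le hR hlt.le, rfl, hlt⟩⟩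
    have hev : shrink R =ᶠ[𝓝 x] fun _ => (1 : ℝ) := by
      filter_upwards [continuous_norm.continuousAt.eventually_lt_const hlt] with y hy
      exact shrink_of_le hR (le_of_lt hy)
    rw [hev.hasLineDerivAt_iff]
    unfold HasLineDerivAt
    simpa using hasDerivAt_const (0 : ℝ) (1 : ℝ)
  · have hr : 0 < ‖x‖ := hR.trans hgt
    have hs : shrink R x = R / ‖x‖ := shrink_of_ge hgt.le
    refine ⟨R / ‖x‖ ^ 3, fun j => ?_, Or.inr ⟨?_, ?_, ?_, hgt⟩⟩
    · have hev : shrink R =ᶠ[𝓝 x] fun y => R / ‖y‖ := by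
        filter_upwards [continuous_norm.continuousAt.eventually_const_lt hgt] with y hy
        exact shrink_of_ge (le_of_lt hy)
      rw [hev.hasLineDerivAt_iff]
      have h := (hasLineDerivAt_inv_norm (norm_pos_iff.1 hr) j).const_mul R
      refine HasDerivAt.congr_deriv h ?_
      field_simp
    all_goals rw [hs]; field_simp

end ball

section fields

/-- The Newtonian potential `G` of the density `q 1_{B(0,R)}`, the solution of
`ΔG = q 1_{B(0,R)}`, written as a polynomial in the contraction factor and the projection. -/
noncomputable def potential (q R : ℝ) (x : Space) : ℝ :=
  q * ((projSq R x - R ^ 2) / 6 - R ^ 2 / 3 * shrink R x)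

/-- The `i`-th partial derivative of `potential q R`. -/
noncomputable def potentialGrad (q R : ℝ) (i : Fin 3) (x : Space) : ℝ :=
  q / 3 * shrink R x ^ 2 * proj R i x

/-- The `i`-th partial derivative `xᵢ h` of the radial function `Φ` with `ΔΦ = potential q R`. -/
noncomputable def bipotentialGrad (q R : ℝ) (i : Fin 3) (x : Space) : ℝ :=
  q * proj R i x * ((projSq R x - R ^ 2) / 30 + R ^ 2 * (shrink R x ^ 2 / 30 - 1 / 6))

/-- The isotropic part `h` of the Hessian of `Φ`. -/
noncomputable def bipotentialIso (q R : ℝ) (x : Space) : ℝ :=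
  q * ((projSq R x - R ^ 2) / 30 + R ^ 2 * (shrink R x ^ 3 / 30 - shrink R x / 6))

/-- The part `k xᵢ xⱼ` of the Hessian of `Φ`, whose other part is `h δᵢⱼ`. -/
noncomputable def bipotentialAniso (q R : ℝ) (i j : Fin 3) (x : Space) : ℝ :=
  q * (shrink R x / 6 - shrink R x ^ 3 / 10) * (proj R i x * proj R j x)

/-- The velocity `u = ΔΦ e₃ - ∇∂₃Φ` generated by the density `q 1_{B(0,R)}`. -/
noncomputable def ballVelocity (q R : ℝ) (x : Space) : Space :=
  WithLp.toLp 2 fun i => (if i = 2 then potential q R x - bipotentialIso q R x else 0) -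
    bipotentialAniso q R 2 i x

variable {q R : ℝ}

lemma ballVelocity_apply (x : Space) (i : Fin 3) : ballVelocity q R x i =
    (if i = 2 then potential q R x - bipotentialIso q R x else 0) -
      bipotentialAniso q R 2 i x := rfl

lemma isBddLip_potential (hR : 0 < R) : IsBddLip (potential q R) := by
  have h := ((((isBddLip_projSq hR).sub (.const (R ^ 2))).const_mul (1 / 6)).sub
    ((isBddLip_shrink hR).const_mul (R ^ 2 / 3))).const_mul q
  refine cast (congrArg IsBddLip (funext fun x => ?_)) h
  simp only [potential]
  ring

lemma isBddLip_potentialGrad (hR : 0 < R) (i : Fin 3) : IsBddLip (potentialGrad q R i) :=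
  (((isBddLip_shrink hR).pow 2).const_mul (q / 3)).mul (isBddLip_proj hR i)

lemma isBddLip_bipotentialGrad (hR : 0 < R) (i : Fin 3) : IsBddLip (bipotentialGrad q R i) := by
  have h := ((isBddLip_proj hR i).const_mul q).mul
    ((((isBddLip_projSq hR).sub (.const (R ^ 2))).const_mul (1 / 30)).add
      (((((isBddLip_shrink hR).pow 2).const_mul (1 / 30)).sub (.const (1 / 6))).const_mul (R ^ 2)))
  refine cast (congrArg IsBddLip (funext fun x => ?_)) h
  simp only [bipotentialGrad]
  ring

lemma isBddLip_bipotentialIso (hR : 0 < R) : IsBddLip (bipotentialIso q R) := by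
  have h := ((((isBddLip_projSq hR).sub (.const (R ^ 2))).const_mul (1 / 30)).add
      (((((isBddLip_shrink hR).pow 3).const_mul (1 / 30)).sub
        ((isBddLip_shrink hR).const_mul (1 / 6))).const_mul (R ^ 2))).const_mul q
  refine cast (congrArg IsBddLip (funext fun x => ?_)) h
  simp only [bipotentialIso]
  ring

lemma isBddLip_bipotentialAniso (hR : 0 < R) (i j : Fin 3) :
    IsBddLip (bipotentialAniso q R i j) := by
  have h := ((((isBddLip_shrink hR).const_mul (1 / 6)).sub
    (((isBddLip_shrink hR).pow 3).const_mul (1 / 10))).const_mul q).mul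
      ((isBddLip_proj hR i).mul (isBddLip_proj hR j))
  refine cast (congrArg IsBddLip (funext fun x => ?_)) h
  simp only [bipotentialAniso]
  ring

lemma isBddLip_ballVelocity (hR : 0 < R) (i : Fin 3) :
    IsBddLip fun x => ballVelocity q R x i := by
  simp only [ballVelocity_apply]
  refine IsBddLip.sub ?_ (isBddLip_bipotentialAniso hR 2 i)
  split_ifs
  · exact (isBddLip_potential hR).sub (isBddLip_bipotentialIso hR)
  · exact .const 0

/-- Inside the ball `s = 1`; outside, `|y| = R`. -/
lemma shrink_eq_one_or_projSq_eq (hR : 0 < R) (x : Space) :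
    shrink R x = 1 ∨ projSq R x = R ^ 2 := by
  rcases le_total ‖x‖ R with h | h
  · exact Or.inl (shrink_of_le hR h)
  · right
    rw [projSq_eq, shrink_of_ge h]
    have : ‖x‖ ≠ 0 := (hR.trans_le h).ne'
    field_simp

/-- `ΔΦ = G`. -/
lemma potential_eq_trace (hR : 0 < R) (x : Space) :
    potential q R x = 3 * bipotentialIso q R x + ∑ i, bipotentialAniso q R i i x := by
  have h1 : ∑ i, bipotentialAniso q R i i x =
      q * (shrink R x / 6 - shrink R x ^ 3 / 10) * projSq R x := by
    simp only [Fin.sum_univ_three, bipotentialAniso, projSq]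
    ring
  rw [h1]
  simp only [potential, bipotentialIso]
  rcases shrink_eq_one_or_projSq_eq hR x with h | h <;> rw [h] <;> ring

section derivatives

variable {x : Space}

/-- Complements `exists_hasLineDerivAt_proj` by `∂ⱼ |y| ^ 2 = 2 θ xⱼ`, where `θ = 1` inside the
sphere and `θ = 0` outside. All pointwise identities below are checked on these two cases. -/
lemma exists_hasLineDerivAt_projSq (hR : 0 < R) (hx : ‖x‖ ≠ R) :
    ∃ τ θ : ℝ, (∀ j, HasLineDerivAt ℝ (shrink R) (-(τ * x j)) x (unitVec j)) ∧
      (∀ i j, HasLineDerivAt ℝ (proj R i)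
        (shrink R x * (if i = j then 1 else 0) - τ * x i * x j) x (unitVec j)) ∧
      (∀ j, HasLineDerivAt ℝ (projSq R) (2 * θ * x j) x (unitVec j)) ∧
      ((shrink R x = 1 ∧ τ = 0 ∧ θ = 1 ∧ ‖x‖ < R) ∨
        (τ = shrink R x ^ 3 / R ^ 2 ∧ θ = 0 ∧ projSq R x = R ^ 2 ∧
          τ * ‖x‖ ^ 2 = shrink R x ∧ R < ‖x‖)) := by
  obtain ⟨τ, h1, h2, h3⟩ := exists_hasLineDerivAt_proj hR hx
  refine ⟨τ, shrink R x ^ 2 - shrink R x * (τ * ‖x‖ ^ 2), h1, h2, fun j => ?_, ?_⟩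
  · have h := (((h2 0 j).pow 2).add ((h2 1 j).pow 2)).add ((h2 2 j).pow 2)
    simp only [zero_smul, add_zero] at h
    refine HasDerivAt.congr_deriv h ?_
    rw [norm_sq_eq_sum]
    simp only [proj]
    fin_cases j <;> simp <;> ring
  · rcases h3 with ⟨a, b, c⟩ | ⟨a, b, c, d⟩
    · left
      refine ⟨a, b, ?_, c⟩
      rw [a, b]
      ring
    · right
      refine ⟨?_, ?_, ?_, c, d⟩
      · rw [← a]
        field_simp
      · rw [c]
        ring
      · rw [projSq_eq, b]

lemma hasLineDerivAt_potential (hR : 0 < R) (hx : ‖x‖ ≠ R) (j : Fin 3) :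
    HasLineDerivAt ℝ (potential q R) (potentialGrad q R j x) x (unitVec j) := by
  obtain ⟨τ, θ, h1, -, h3, h4⟩ := exists_hasLineDerivAt_projSq hR hx
  have h := ((((h3 j).sub_const (R ^ 2)).div_const 6).sub
    ((h1 j).const_mul (R ^ 2 / 3))).const_mul q
  refine HasDerivAt.congr_deriv h ?_
  simp only [potentialGrad, proj]
  rcases h4 with ⟨a, b, c, -⟩ | ⟨a, b, c, -, -⟩
  · rw [a, b, c]
    ring
  · rw [a, b]
    field_simp
    ring

lemma hasLineDerivAt_bipotentialGrad (hR : 0 < R) (hx : ‖x‖ ≠ R) (i j : Fin 3) :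
    HasLineDerivAt ℝ (bipotentialGrad q R i) ((if i = j then bipotentialIso q R x else 0) +
      bipotentialAniso q R i j x) x (unitVec j) := by
  obtain ⟨τ, θ, h1, h2, h3, h4⟩ := exists_hasLineDerivAt_projSq hR hx
  have h := ((h2 i j).const_mul q).mul ((((h3 j).sub_const (R ^ 2)).div_const 30).add
    ((((h1 j).pow 2).div_const 30).sub_const (1 / 6) |>.const_mul (R ^ 2)))
  simp only [zero_smul, add_zero] at h
  refine HasDerivAt.congr_deriv h ?_
  have hδ : (if i = j then bipotentialIso q R x else 0) =
    (if i = j then 1 else 0) * bipotentialIso q R x := by split_ifs <;> ring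
  rw [hδ]
  generalize (if i = j then (1 : ℝ) else 0) = d
  simp only [bipotentialIso, bipotentialAniso, Pi.add_apply, Pi.pow_apply]
  simp only [zero_smul, add_zero]
  rcases h4 with ⟨a, b, c, -⟩ | ⟨a, b, c, -, -⟩
  · simp only [proj]
    rw [a, b, c]
    ring
  · rw [c]
    simp only [proj]
    rw [a, b]
    field_simp
    ring

/-- `ΔG = q 1_{B(0,R)}` away from the sphere. -/
lemma hasLineDerivAt_potentialGrad (hR : 0 < R) (hx : ‖x‖ ≠ R) :
    ∃ d : Fin 3 → ℝ, (∀ i, HasLineDerivAt ℝ (potentialGrad q R i) (d i) x (unitVec i)) ∧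
      ∑ i, d i = (ball (0 : Space) R).indicator (fun _ => q) x := by
  obtain ⟨τ, θ, h1, h2, -, h4⟩ := exists_hasLineDerivAt_projSq hR hx
  have h := fun i => (((h1 i).pow 2).const_mul (q / 3)).mul (h2 i i)
  simp only [zero_smul, add_zero] at h
  refine ⟨_, h, ?_⟩
  simp only [Fin.sum_univ_three, proj, if_true]
  have hn := norm_sq_eq_sum x
  rcases h4 with ⟨a, b, c, e⟩ | ⟨a, b, c, e, f⟩
  · rw [indicator_of_mem (by simpa using e)]
    simp only [Pi.pow_apply, zero_smul, add_zero]
    rw [a, b]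
    ring
  · rw [indicator_of_notMem (by simpa using f.le)]
    simp only [Pi.pow_apply, zero_smul, add_zero]
    rw [hn] at e
    simp only [Nat.cast_ofNat, Nat.add_one_sub_one, pow_one]
    linear_combination (-q * shrink R x ^ 2) * e

/-- The velocity generated by the ball is divergence free away from the sphere. -/
lemma hasLineDerivAt_ballVelocity (hR : 0 < R) (hx : ‖x‖ ≠ R) :
    ∃ d : Fin 3 → ℝ, (∀ i, HasLineDerivAt ℝ (fun x => ballVelocity q R x i) (d i) x (unitVec i)) ∧
      ∑ i, d i = 0 := by
  obtain ⟨τ, θ, h1, h2, h3, h4⟩ := exists_hasLineDerivAt_projSq hR hx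
  have hT := fun i => (((h1 i).div_const 6).sub (((h1 i).pow 3).div_const 10)).const_mul q |>.mul
    ((h2 2 i).mul (h2 i i))
  have hI : HasLineDerivAt ℝ (bipotentialIso q R)
      (q * (2 * θ * x 2 / 30 + R ^ 2 * (-(τ * x 2) * shrink R x ^ 2 / 10 + τ * x 2 / 6))) x
      (unitVec 2) := by
    have h := ((((h3 2).sub_const (R ^ 2)).div_const 30).add
      ((((h1 2).pow 3).div_const 30).sub ((h1 2).div_const 6) |>.const_mul (R ^ 2))).const_mul q
    simp only [zero_smul, add_zero] at h
    refine HasDerivAt.congr_deriv h ?_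
    simp only [Nat.cast_ofNat, Nat.add_one_sub_one]
    ring
  have hG := hasLineDerivAt_potential (q := q) hR hx 2
  refine ⟨fun i => (if i = 2 then potentialGrad q R 2 x -
    (q * (2 * θ * x 2 / 30 + R ^ 2 * (-(τ * x 2) * shrink R x ^ 2 / 10 + τ * x 2 / 6))) else 0) - _,
    fun i => HasDerivAt.sub ?_ (hT i), ?_⟩
  · by_cases hi : i = 2
    · subst hi
      simp only [if_true]
      exact HasDerivAt.sub hG hI
    · simp only [hi, if_false]
      exact hasDerivAt_const _ _
  · have hn := norm_sq_eq_sum x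
    simp only [Fin.sum_univ_three, Pi.sub_apply, Pi.mul_apply, Pi.pow_apply, zero_smul, add_zero,
      Nat.cast_ofNat, Nat.add_one_sub_one]
    simp [potentialGrad, proj]
    rcases h4 with ⟨a, b, c, e⟩ | ⟨a, b, c, e, f⟩
    · rw [a, b, c]
      ring
    · rw [hn] at e
      have b' : τ * R ^ 2 = shrink R x ^ 3 := by
        rw [a]
        field_simp
      rw [b]
      linear_combination (q * x 2 * (shrink R x ^ 2 / 2 - shrink R x ^ 4 / 2)) * e +
        (q * x 2 * (shrink R x ^ 2 / 10 - 1 / 6)) * b'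

end derivatives

end fields

/-! ### The Stokes equations for the ball -/

section weak

variable {q R : ℝ} {ψ : Space → ℝ}

lemma integral_potential_mul_pd (hR : 0 < R) (hψ : ContDiff ℝ ∞ ψ) (hc : HasCompactSupport ψ)
    (j : Fin 3) :
    ∫ x, potential q R x * pd j ψ x = -∫ x, potentialGrad q R j x * ψ x := by
  obtain ⟨L, hL⟩ := lipschitz_of_smooth hψ hc
  refine integral_deriv_mul_eq (isBddLip_potential hR) ?_ hL hc
  filter_upwards [ae_norm_ne R] with x hx using hasLineDerivAt_potential hR hx j

/-- `ΔG = q 1_{B(0,R)}`. -/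
lemma integral_potential_mul_lap (hR : 0 < R) (hψ : ContDiff ℝ ∞ ψ) (hc : HasCompactSupport ψ) :
    ∫ x, potential q R x * lap ψ x = q * ∫ x in ball 0 R, ψ x := by
  obtain ⟨L, hL⟩ := lipschitz_of_smooth hψ hc
  have hae : ∀ i, ∀ᵐ x : Space, HasLineDerivAt ℝ (potentialGrad q R i)
      (lineDeriv ℝ (potentialGrad q R i) x (unitVec i)) x (unitVec i) := by
    intro i
    filter_upwards [ae_norm_ne R] with x hx
    obtain ⟨d, hd, -⟩ := hasLineDerivAt_potentialGrad (q := q) hR hx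
    exact (hd i).lineDifferentiableAt.hasLineDerivAt
  have h1 : ∀ i, ∫ x, potential q R x * pd i (pd i ψ) x =
      ∫ x, lineDeriv ℝ (potentialGrad q R i) x (unitVec i) * ψ x := by
    intro i
    rw [integral_potential_mul_pd hR (contDiff_pd hψ i) (hasCompactSupport_pd hc i),
      integral_deriv_mul_eq (isBddLip_potentialGrad hR i) (hae i) hL hc, neg_neg]
  simp only [lap, Finset.mul_sum]
  rw [integral_finsetSum]
  · simp only [h1]
    rw [← integral_finsetSum]
    · rw [← integral_const_mul, ← integral_indicator measurableSet_ball]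
      refine integral_congr_ae ?_
      filter_upwards [ae_norm_ne R] with x hx
      obtain ⟨d, hd, hsum⟩ := hasLineDerivAt_potentialGrad (q := q) hR hx
      rw [← Finset.sum_mul, Finset.sum_congr rfl fun i _ => (hd i).lineDeriv, hsum]
      by_cases hx' : x ∈ ball (0 : Space) R
      · simp only [indicator_of_mem hx']
      · simp only [indicator_of_notMem hx', zero_mul]
    · exact fun i _ => integrable_deriv_mul (isBddLip_potentialGrad hR i) (hae i) hL hc
  · exact fun i _ => integrable_mul_of_compactSupport (isBddLip_potential hR).continuous
      (contDiff_pd (contDiff_pd hψ i) i).continuous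
      (hasCompactSupport_pd (hasCompactSupport_pd hc i) i)

lemma integral_bipotentialGrad_mul_pd (hR : 0 < R) (hψ : ContDiff ℝ ∞ ψ)
    (hc : HasCompactSupport ψ) (i j : Fin 3) :
    ∫ x, bipotentialGrad q R i x * pd j ψ x =
      -∫ x, ((if i = j then bipotentialIso q R x else 0) + bipotentialAniso q R i j x) * ψ x := by
  obtain ⟨L, hL⟩ := lipschitz_of_smooth hψ hc
  refine integral_deriv_mul_eq (isBddLip_bipotentialGrad hR i) ?_ hL hc
  filter_upwards [ae_norm_ne R] with x hx using hasLineDerivAt_bipotentialGrad hR hx i j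

lemma continuous_hessian (hR : 0 < R) (i j : Fin 3) : Continuous fun x =>
    (if i = j then bipotentialIso q R x else 0) + bipotentialAniso q R i j x := by
  refine Continuous.add ?_ (isBddLip_bipotentialAniso hR i j).continuous
  split_ifs
  · exact (isBddLip_bipotentialIso hR).continuous
  · exact continuous_const

/-- `Δ ∂ᵢΦ = ∂ᵢ ΔΦ = ∂ᵢ G`. -/
lemma integral_bipotentialGrad_mul_lap (hR : 0 < R) (hψ : ContDiff ℝ ∞ ψ)
    (hc : HasCompactSupport ψ) (i : Fin 3) :
    ∫ x, bipotentialGrad q R i x * lap ψ x = ∫ x, potentialGrad q R i x * ψ x := by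
  have hsymm : ∀ j x, (if i = j then bipotentialIso q R x else 0) + bipotentialAniso q R i j x =
      (if j = i then bipotentialIso q R x else 0) + bipotentialAniso q R j i x := by
    intro j x
    simp only [bipotentialAniso, eq_comm (a := i)]
    ring
  have hpd := fun j => contDiff_pd hψ j
  have hpdc := fun j => hasCompactSupport_pd hc j
  have h1 : ∀ j, ∫ x, bipotentialGrad q R i x * pd j (pd j ψ) x =
      -∫ x, (bipotentialIso q R x + bipotentialAniso q R j j x) * pd i ψ x := by
    intro j
    rw [integral_bipotentialGrad_mul_pd hR (hpd j) (hpdc j)]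
    simp only [hsymm j]
    rw [← integral_bipotentialGrad_mul_pd hR (hpd j) (hpdc j),
      show pd i (pd j ψ) = pd j (pd i ψ) from funext fun y => pd_comm hψ i j y,
      integral_bipotentialGrad_mul_pd hR (hpd i) (hpdc i)]
    simp only [if_true]
  simp only [lap, Finset.mul_sum]
  rw [integral_finsetSum]
  · simp only [h1]
    rw [Finset.sum_neg_distrib, ← integral_finsetSum]
    · have h2 : ∀ x, ∑ j : Fin 3, (bipotentialIso q R x + bipotentialAniso q R j j x) *
          pd i ψ x = potential q R x * pd i ψ x := by
        intro x
        rw [← Finset.sum_mul, potential_eq_trace hR]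
        simp [Finset.sum_add_distrib]
      simp only [h2]
      rw [integral_potential_mul_pd hR hψ hc, neg_neg]
    · exact fun j _ => integrable_mul_of_compactSupport
        ((isBddLip_bipotentialIso hR).add (isBddLip_bipotentialAniso hR j j)).continuous
        (hpd i).continuous (hpdc i)
  · exact fun j _ => integrable_mul_of_compactSupport (isBddLip_bipotentialGrad hR i).continuous
      (contDiff_pd (hpd j) j).continuous (hasCompactSupport_pd (hpdc j) j)

lemma continuous_ballVelocity (hR : 0 < R) : Continuous (ballVelocity q R) :=
  (PiLp.continuous_toLp 2 _).comp
    (continuous_pi fun i => (isBddLip_ballVelocity (q := q) hR i).continuous)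

lemma norm_le_sum_abs_coord (v : Space) : ‖v‖ ≤ ∑ i, |v i| := by
  rw [EuclideanSpace.norm_eq]
  refine Real.sqrt_le_iff.2 ⟨Finset.sum_nonneg fun i _ => abs_nonneg _, ?_⟩
  simp only [Real.norm_eq_abs, Fin.sum_univ_three]
  nlinarith [mul_nonneg (abs_nonneg (v 0)) (abs_nonneg (v 1)),
    mul_nonneg (abs_nonneg (v 0)) (abs_nonneg (v 2)),
    mul_nonneg (abs_nonneg (v 1)) (abs_nonneg (v 2))]

lemma exists_lipschitzWith_of_coord {v : Space → Space} (h : ∀ i, IsBddLip fun x => v x i) :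
    ∃ K : ℝ≥0, LipschitzWith K v := by
  choose K hK using fun i => (h i).lipschitz
  refine ⟨∑ i, K i, LipschitzWith.of_dist_le_mul fun x y => ?_⟩
  rw [dist_eq_norm]
  refine (norm_le_sum_abs_coord _).trans ?_
  rw [NNReal.coe_sum, Finset.sum_mul]
  exact Finset.sum_le_sum fun i _ => (hK i).dist_le_mul x y

lemma exists_norm_le_of_coord {v : Space → Space} (h : ∀ i, IsBddLip fun x => v x i) :
    ∃ C : ℝ≥0, ∀ x, ‖v x‖ ≤ C := by
  choose C hC using fun i => (h i).bounded
  refine ⟨(∑ i, C i).toNNReal, fun x => ?_⟩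
  exact (norm_le_sum_abs_coord _).trans ((Finset.sum_le_sum fun i _ => hC i x).trans
    (Real.le_coe_toNNReal _))

/-- The velocity of the ball, also in a moving frame, is weakly divergence free. -/
lemma integral_fderiv_ballVelocity_sub (hR : 0 < R) (c : Space) {L : ℝ≥0} {g : Space → ℝ}
    (hg : LipschitzWith L g) (hgc : HasCompactSupport g) :
    ∫ x, fderiv ℝ g x (ballVelocity q R x - c) = 0 := by
  have hf := fun i => (isBddLip_ballVelocity (q := q) hR i).sub (.const (c i))
  have hder : ∀ x : Space, ‖x‖ ≠ R → ∃ d : Fin 3 → ℝ, (∀ i, HasLineDerivAt ℝ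
      (fun x => ballVelocity q R x i - c i) (d i) x (unitVec i)) ∧ ∑ i, d i = 0 := by
    intro x hx
    obtain ⟨d, hd, hsum⟩ := hasLineDerivAt_ballVelocity (q := q) hR hx
    exact ⟨d, fun i => HasDerivAt.sub_const (c i) (hd i), hsum⟩
  have hae : ∀ i, ∀ᵐ x : Space, HasLineDerivAt ℝ (fun x => ballVelocity q R x i - c i)
      (lineDeriv ℝ (fun x => ballVelocity q R x i - c i) x (unitVec i)) x (unitVec i) := by
    intro i
    filter_upwards [ae_norm_ne R] with x hx
    obtain ⟨d, hd, -⟩ := hder x hx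
    exact (hd i).lineDifferentiableAt.hasLineDerivAt
  have hexp : ∀ x, fderiv ℝ g x (ballVelocity q R x - c) =
      ∑ i, (ballVelocity q R x i - c i) * pd i g x := by
    intro x
    have : ballVelocity q R x - c = ∑ i, (ballVelocity q R x i - c i) • unitVec i := by
      ext j
      simp [unitVec_apply, Fin.sum_univ_three]
      fin_cases j <;> simp
    conv_lhs => rw [this]
    rw [map_sum]
    simp only [map_smul, smul_eq_mul, pd]
  simp only [hexp]
  rw [integral_finsetSum _ fun i _ => integrable_pd_mul (hf i).continuous hg hgc i]
  simp only [fun i => integral_deriv_mul_eq (hf i) (hae i) hg hgc]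
  rw [Finset.sum_neg_distrib,
    ← integral_finsetSum _ fun i _ => integrable_deriv_mul (hf i) (hae i) hg hgc, neg_eq_zero]
  refine integral_eq_zero_of_ae ?_
  filter_upwards [ae_norm_ne R] with x hx
  obtain ⟨d, hd, hsum⟩ := hder x hx
  rw [← Finset.sum_mul, Finset.sum_congr rfl fun i _ => (hd i).lineDeriv, hsum, zero_mul]
  rfl

lemma tendsto_shrink (R : ℝ) : Tendsto (shrink R) (cocompact Space) (𝓝 0) := by
  have h : Tendsto (fun x : Space => max ‖x‖ R) (cocompact Space) atTop :=
    tendsto_atTop_mono (fun x => le_max_left _ _) (tendsto_norm_cocompact_atTop (E := Space))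
  exact h.const_div_atTop R

lemma tendsto_ballVelocity (hR : 0 < R) :
    Tendsto (ballVelocity q R) (cocompact Space) (𝓝 0) := by
  have hs := tendsto_shrink R
  have hout : ∀ᶠ x : Space in cocompact Space, R ≤ ‖x‖ :=
    (tendsto_norm_cocompact_atTop (E := Space)).eventually_ge_atTop R
  have hQ : Tendsto (fun x => projSq R x - R ^ 2) (cocompact Space) (𝓝 0) := by
    refine tendsto_const_nhds.congr' ?_
    filter_upwards [hout] with x hx
    have : ‖x‖ ≠ 0 := (hR.trans_le hx).ne'
    rw [projSq_eq, shrink_of_ge hx]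
    field_simp
    ring
  have hcoord : ∀ i, Tendsto (fun x => ballVelocity q R x i) (cocompact Space) (𝓝 0) := by
    intro i
    have h1 : Tendsto (bipotentialAniso q R 2 i) (cocompact Space) (𝓝 0) := by
      have h := ((hs.div_const 6).sub ((hs.pow 3).div_const 10)).const_mul q
      simp only [zero_div, ne_eq, OfNat.ofNat_ne_zero, not_false_eq_true, zero_pow, sub_zero,
        mul_zero] at h
      refine h.zero_mul_isBoundedUnder_le
        (isBoundedUnder_of ⟨R * R, fun x => ?_⟩)
      simp only [Function.comp_apply, Real.norm_eq_abs, abs_mul]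
      exact mul_le_mul (abs_proj_le hR 2 x) (abs_proj_le hR i x) (abs_nonneg _) hR.le
    have h2 : Tendsto (fun x => potential q R x - bipotentialIso q R x) (cocompact Space)
        (𝓝 0) := by
      have ha := ((hQ.div_const 6).sub (hs.const_mul (R ^ 2 / 3))).const_mul q
      have hb := ((hQ.div_const 30).add ((((hs.pow 3).div_const 30).sub
        (hs.div_const 6)).const_mul (R ^ 2))).const_mul q
      simpa [potential, bipotentialIso] using ha.sub hb
    simp only [ballVelocity_apply]
    split_ifs
    · simpa using h2.sub h1
    · simpa using h1.neg
  have := (PiLp.continuous_toLp 2 (fun _ : Fin 3 => ℝ)).tendsto 0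
  have h := this.comp (tendsto_pi_nhds.2 hcoord)
  simpa [Function.comp_def] using h

/-- The momentum equation for the velocity of the ball: `u = G e₃ - ∇∂₃Φ` solves
`-Δu + ∇p = -q 1_{B(0,R)} e₃` with `p = -∂₃G`. -/
lemma integral_inner_ballVelocity_laplacian (hR : 0 < R) {φ : Space → Space}
    (hφ : ContDiff ℝ ∞ φ) (hc : HasCompactSupport φ) :
    ∫ x, ⟪ballVelocity q R x, (Laplacian.laplacian φ : Space → Space) x⟫_ℝ =
      q * (∫ x in ball 0 R, φ x 2) + ∫ x, potentialGrad q R 2 x * divergence φ x := by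
  have hφi := fun i => contDiff_coord hφ i
  have hci := fun i => hasCompactSupport_coord hc i
  let lφ : Fin 3 → Space → ℝ := fun i => lap fun y => φ y i
  have hlφ : ∀ i, ContDiff ℝ ∞ (lφ i) := fun i => contDiff_lap (hφi i)
  have hlc : ∀ i, HasCompactSupport (lφ i) := fun i => hasCompactSupport_lap (hci i)
  have h1 : ∀ x, ⟪ballVelocity q R x, (Laplacian.laplacian φ : Space → Space) x⟫_ℝ =
      potential q R x * lφ 2 x - ∑ i, ((if 2 = i then bipotentialIso q R x else 0) +
        bipotentialAniso q R 2 i x) * lφ i x := by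
    intro x
    rw [inner_eq_sum]
    simp only [laplacian_coord hφ, ballVelocity_apply, Fin.sum_univ_three, lφ]
    simp
    ring
  have hint : ∀ i, Integrable fun x => ((if 2 = i then bipotentialIso q R x else 0) +
      bipotentialAniso q R 2 i x) * lφ i x := fun i =>
    integrable_mul_of_compactSupport (continuous_hessian hR 2 i) (hlφ i).continuous (hlc i)
  have h2 : ∀ i, ∫ x, ((if 2 = i then bipotentialIso q R x else 0) +
      bipotentialAniso q R 2 i x) * lφ i x =
        -∫ x, potentialGrad q R 2 x * pd i (fun y => φ y i) x := by
    intro i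
    rw [← integral_bipotentialGrad_mul_lap hR (contDiff_pd (hφi i) i)
      (hasCompactSupport_pd (hci i) i), ← neg_eq_iff_eq_neg,
      ← integral_bipotentialGrad_mul_pd hR (hlφ i) (hlc i)]
    simp only [lφ, pd_lap (hφi i)]
  simp only [h1]
  rw [integral_sub (integrable_mul_of_compactSupport (isBddLip_potential hR).continuous
    (hlφ 2).continuous (hlc 2)) (integrable_finsetSum _ fun i _ => hint i),
    integral_finsetSum _ fun i _ => hint i, Finset.sum_congr rfl fun i _ => h2 i,
    integral_potential_mul_lap hR (hφi 2) (hci 2)]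
  simp only [divergence_eq hφ, Finset.mul_sum]
  rw [integral_finsetSum _ fun i _ => integrable_mul_of_compactSupport
    (isBddLip_potentialGrad hR 2).continuous (contDiff_pd (hφi i) i).continuous
    (hasCompactSupport_pd (hci i) i), Finset.sum_neg_distrib]
  ring

lemma volume_ball_ne_zero (hR : 0 < R) (a : Space) : volume (ball a R) ≠ 0 :=
  (measure_ball_pos _ a hR).ne'

lemma isStokesVelocity_ballVelocity (hR : 0 < R) :
    IsStokesVelocity (patch R) (ballVelocity (volume.real (ball (0 : Space) R))⁻¹ R) where
  continuous := continuous_ballVelocity hR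
  tendsto_zero := tendsto_ballVelocity hR
  div_eq_zero ψ hψ hc := by
    obtain ⟨L, hL⟩ := lipschitz_of_smooth hψ hc
    have := integral_fderiv_ballVelocity_sub (q := (volume.real (ball (0 : Space) R))⁻¹) hR 0 hL hc
    rw [← this]
    refine integral_congr_ae (Eventually.of_forall fun x => ?_)
    simp only [sub_zero]
    rw [real_inner_comm, gradient, InnerProductSpace.toDual_symm_apply]
  momentum := by
    refine ⟨fun x => -potentialGrad (volume.real (ball (0 : Space) R))⁻¹ R 2 x,
      (isBddLip_potentialGrad hR 2).continuous.neg.locallyIntegrable, fun φ hφ hc => ?_⟩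
    rw [integral_inner_ballVelocity_laplacian hR hφ hc]
    simp only [neg_mul, integral_neg, e₃_eq, inner_unitVec, patch, uniformBall,
      integral_smul_measure, ENNReal.toReal_inv, smul_eq_mul, measureReal_def]
    ring

end weak

/-! ### The travelling wave is a solution -/

lemma IsStokesVelocity.translate {ρ : Measure Space} {u : Space → Space}
    (h : IsStokesVelocity ρ u) (a : Space) :
    IsStokesVelocity (ρ.map (· + a)) (fun x => u (x - a)) where
  continuous := h.continuous.comp (continuous_id.sub continuous_const)
  tendsto_zero := by
    refine h.tendsto_zero.comp ?_
    simpa [sub_eq_add_neg] using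
      (Homeomorph.addRight (-a)).isClosedEmbedding.tendsto_cocompact
  div_eq_zero ψ hψ hc := by
    have h1 := h.div_eq_zero (fun x => ψ (x + a)) (hψ.comp (contDiff_id.add contDiff_const))
      (hc.comp_homeomorph (Homeomorph.addRight a))
    rw [← integral_sub_right_eq_self _ a] at h1
    simpa [gradient, fderiv_comp_add_right] using h1
  momentum := by
    obtain ⟨p, hp, hmom⟩ := h.momentum
    refine ⟨fun x => p (x - a), ?_, fun φ hφ hc => ?_⟩
    · have h1 := locallyIntegrable_map_homeomorph (Homeomorph.subRight a) (f := p)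
        (μ := (volume : Measure Space))
      rw [show Measure.map (Homeomorph.subRight a) (volume : Measure Space) = volume from
        (measurePreserving_sub_right volume a).map_eq] at h1
      exact h1.1 hp
    · have h1 := hmom (fun x => φ (x + a)) (hφ.comp (contDiff_id.add contDiff_const))
        (hc.comp_homeomorph (Homeomorph.addRight a))
      have hlap : ∀ x, (Laplacian.laplacian (fun x => φ (x + a)) : Space → Space) x =
          (Laplacian.laplacian φ : Space → Space) (x + a) := by
        intro x
        simp only [InnerProductSpace.laplacian_eq_iteratedFDeriv_stdOrthonormalBasis,
          iteratedFDeriv_comp_add_right]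
      have hdiv : ∀ x, divergence (fun x => φ (x + a)) x = divergence φ (x + a) := by
        intro x
        simp only [divergence, fderiv_comp_add_right]
      simp only [hlap, hdiv] at h1
      rw [integral_map (by fun_prop)
        (continuous_const.inner hφ.continuous).aestronglyMeasurable, ← h1,
        ← integral_sub_right_eq_self (fun x => ⟪u x, _⟫_ℝ) a,
        ← integral_sub_right_eq_self (fun x => p x * _) a]
      simp only [sub_add_cancel]

/-- A solution of a scalar differential inequality `|f'| ≤ C |f|` with a zero vanishes
identically. -/
lemma eq_zero_of_abs_deriv_le {f f' : ℝ → ℝ} {C : ℝ} (hf : ∀ t, HasDerivAt f (f' t) t)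
    (hC : ∀ t, |f' t| ≤ C * |f t|) {t₀ : ℝ} (h0 : f t₀ = 0) (t : ℝ) : f t = 0 := by
  rcases le_total t₀ t with h | h
  · exact eq_zero_of_abs_deriv_le_mul_abs_self_of_eq_zero_right (K := C)
      (fun s _ => (hf s).continuousAt.continuousWithinAt) (fun s _ => (hf s).hasDerivWithinAt)
      h0 (fun s _ => hC s) t ⟨h, le_rfl⟩
  · have hneg : ∀ s, HasDerivAt (fun s => f (-s)) (-f' (-s)) s := fun s => by
      simpa [Function.comp_def] using (hf (-s)).scomp s (hasDerivAt_neg s)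
    have := eq_zero_of_abs_deriv_le_mul_abs_self_of_eq_zero_right (K := C) (a := -t₀) (b := -t)
      (fun s _ => (hneg s).continuousAt.continuousWithinAt)
      (fun s _ => (hneg s).hasDerivWithinAt)
      (by simpa using h0) (fun s _ => by simpa using hC (-s)) (-t) ⟨by linarith, le_rfl⟩
    simpa using this

section

variable {q R : ℝ}

/-- The velocity of the ball as a whole: the value of the normal component of `ballVelocity q R` on
the sphere is that of this constant vector. -/
noncomputable def driftVelocity (q R : ℝ) : Space := (-(4 / 15 * q * R ^ 2)) • e₃

/-- Relative to the drift, the flow is tangential to the sphere of radius `R`. -/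
lemma abs_inner_ballVelocity_sub_le (hR : 0 < R) (x : Space) :
    |⟪x, ballVelocity q R x - driftVelocity q R⟫_ℝ| ≤ |q| * R * |‖x‖ ^ 2 - R ^ 2| := by
  have hn := norm_sq_eq_sum x
  have h2 : |x 2| ≤ ‖x‖ := abs_coord_le_norm x 2
  rcases le_or_gt ‖x‖ R with h | h
  · have hs := shrink_of_le hR h
    have : ⟪x, ballVelocity q R x - driftVelocity q R⟫_ℝ =
        q * (x 2 / 15) * (‖x‖ ^ 2 - R ^ 2) := by
      rw [inner_eq_sum, hn]
      simp [Fin.sum_univ_three, ballVelocity_apply, driftVelocity, e₃_eq, unitVec_apply,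
        potential, bipotentialIso, bipotentialAniso, projSq, proj, hs]
      ring
    rw [this, abs_mul, abs_mul]
    gcongr
    rw [abs_div, abs_of_pos (by norm_num : (0 : ℝ) < 15)]
    linarith [abs_nonneg (x 2)]
  · have hr : 0 < ‖x‖ := hR.trans h
    have hs := shrink_of_ge h.le
    have hQ := projSq_eq R x
    have hs2 : shrink R x ^ 2 * ‖x‖ ^ 2 = R ^ 2 := by
      rw [hs]
      field_simp
    have : ⟪x, ballVelocity q R x - driftVelocity q R⟫_ℝ =
        q * (x 2 * R ^ 2 * (shrink R x - 1) * (shrink R x ^ 2 + shrink R x - 4) / 15) := by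
      rw [hs2] at hQ
      rw [inner_eq_sum]
      simp only [Fin.sum_univ_three, PiLp.sub_apply, ballVelocity_apply, driftVelocity, e₃_eq,
        potential, bipotentialIso, bipotentialAniso, hQ, proj]
      simp [unitVec_apply]
      rw [hn] at hs2
      linear_combination (-q * x 2 * (shrink R x / 6 - shrink R x ^ 3 / 10)) * hs2
    have hs0 := shrink_pos hR x
    have hs1 := shrink_le_one hR x
    have e1 : |x 2| * |shrink R x - 1| ≤ ‖x‖ - R := by
      have : |shrink R x - 1| = (‖x‖ - R) / ‖x‖ := by
        rw [abs_of_nonpos (by linarith), hs]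
        field_simp
        ring
      rw [this, mul_div_assoc', div_le_iff₀ hr, mul_comm]
      exact mul_le_mul_of_nonneg_left h2 (by linarith)
    have e2 : |shrink R x ^ 2 + shrink R x - 4| ≤ 4 := by
      rw [abs_le]
      constructor <;> nlinarith
    have e3 : R * (‖x‖ - R) ≤ |‖x‖ ^ 2 - R ^ 2| := by
      refine le_trans ?_ (le_abs_self _)
      nlinarith
    rw [this, abs_mul, mul_assoc |q| R]
    refine mul_le_mul_of_nonneg_left ?_ (abs_nonneg q)
    calc |x 2 * R ^ 2 * (shrink R x - 1) * (shrink R x ^ 2 + shrink R x - 4) / 15|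
        = R ^ 2 * (|x 2| * |shrink R x - 1|) * |shrink R x ^ 2 + shrink R x - 4| / 15 := by
          rw [abs_div, abs_mul, abs_mul, abs_mul, abs_of_pos (by positivity : 0 < R ^ 2),
            abs_of_pos (by norm_num : (0 : ℝ) < 15)]
          ring
      _ ≤ R ^ 2 * (‖x‖ - R) * 4 / 15 := by
          have : 0 ≤ ‖x‖ - R := by linarith
          gcongr
      _ ≤ R * (R * (‖x‖ - R)) := by nlinarith [mul_nonneg hR.le (sub_nonneg.2 h.le)]
      _ ≤ R * |‖x‖ ^ 2 - R ^ 2| := by gcongr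

/-- Hence the flow in the moving frame leaves the ball invariant. -/
lemma preimage_ball_of_isFlowOf (hR : 0 < R) {Y : ℝ → Space → Space}
    (hY : IsFlowOf (fun x => ballVelocity q R x - driftVelocity q R) Y) {K : ℝ≥0}
    (hK : LipschitzWith K fun x => ballVelocity q R x - driftVelocity q R) (t : ℝ) :
    Y t ⁻¹' ball 0 R = ball 0 R := by
  have hinv : ∀ t x, x ∈ ball (0 : Space) R → Y t x ∈ ball (0 : Space) R := by
    intro t x hx
    have hder : ∀ s, HasDerivAt (fun s => ‖Y s x‖ ^ 2 - R ^ 2)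
        (2 * ⟪Y s x, ballVelocity q R (Y s x) - driftVelocity q R⟫_ℝ) s := fun s =>
      ((hY.deriv s x).norm_sq).sub_const _
    have hbd : ∀ s, |2 * ⟪Y s x, ballVelocity q R (Y s x) - driftVelocity q R⟫_ℝ| ≤
        2 * (|q| * R) * |‖Y s x‖ ^ 2 - R ^ 2| := fun s => by
      rw [abs_mul, abs_two, mul_assoc]
      gcongr
      exact abs_inner_ballVelocity_sub_le hR _
    have h0 : ‖Y 0 x‖ ^ 2 - R ^ 2 < 0 := by
      rw [hY.zero, sub_neg]
      rw [mem_ball_zero_iff] at hx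
      gcongr
    rw [mem_ball_zero_iff]
    by_contra hcon
    have ht : 0 ≤ ‖Y t x‖ ^ 2 - R ^ 2 := by
      have : R ≤ ‖Y t x‖ := not_lt.1 hcon
      rw [sub_nonneg]
      gcongr
    have hcont : Continuous fun s => ‖Y s x‖ ^ 2 - R ^ 2 :=
      continuous_iff_continuousAt.2 fun s => (hder s).continuousAt
    obtain ⟨t₀, h⟩ := mem_range_of_exists_le_of_exists_ge hcont ⟨0, h0.le⟩ ⟨t, ht⟩
    exact h0.ne (eq_zero_of_abs_deriv_le hder hbd h 0)
  ext x
  refine ⟨fun hx => ?_, hinv t x⟩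
  have := hinv (-t) _ hx
  rwa [hY.neg_cancel hK] at this

end

lemma uniformBall_map {T : Space → Space} (hT : MeasurePreserving T volume volume) {a b : Space}
    {R : ℝ} (h : T ⁻¹' ball b R = ball a R) : (uniformBall a R).map T = uniformBall b R := by
  have h1 := (hT.restrict_preimage (s := ball b R) measurableSet_ball).map_eq
  have h2 := hT.measure_preimage (s := ball b R) measurableSet_ball.nullMeasurableSet
  rw [h] at h1 h2
  rw [uniformBall, uniformBall, Measure.map_smul, h1, h2]

lemma isProbabilityMeasure_uniformBall (a : Space) {R : ℝ} (hR : 0 < R) :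
    IsProbabilityMeasure (uniformBall a R) := by
  refine ⟨?_⟩
  simp only [uniformBall, Measure.smul_apply, Measure.restrict_apply_univ, smul_eq_mul]
  exact ENNReal.inv_mul_cancel (volume_ball_ne_zero hR a) measure_ball_lt_top.ne

lemma uniformBall_le (a : Space) {R : ℝ} (hR : 0 < R) :
    uniformBall a R ≤ ((volume (ball (0 : Space) R))⁻¹.toNNReal) • (volume : Measure Space) := by
  have h : (volume (ball a R))⁻¹ = ((volume (ball (0 : Space) R))⁻¹.toNNReal : ℝ≥0∞) := by
    rw [ENNReal.coe_toNNReal (ENNReal.inv_ne_top.2 (volume_ball_ne_zero hR 0)),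
      Measure.addHaar_ball_center]
  intro s
  rw [uniformBall, h, Measure.smul_apply, Measure.smul_apply]
  simp only [smul_eq_mul]
  rw [ENNReal.smul_def, smul_eq_mul]
  gcongr
  exact Measure.restrict_le_self

lemma volume_real_ball (R : ℝ) (hR : 0 < R) :
    volume.real (ball (0 : Space) R) = R ^ 3 * volume.real (ball (0 : Space) 1) := by
  have h := Measure.addHaar_ball (volume : Measure Space) 0 hR.le
  rw [measureReal_def, h, ENNReal.toReal_mul, ENNReal.toReal_ofReal (by positivity)]
  simp [measureReal_def]

lemma volume_real_ball_pos : 0 < volume.real (ball (0 : Space) 1) :=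
  ENNReal.toReal_pos (volume_ball_ne_zero one_pos 0) measure_ball_lt_top.ne

lemma isBoundedProbability_patch {R : ℝ} (hR : 0 < R) : IsBoundedProbability (patch R) :=
  ⟨isProbabilityMeasure_uniformBall 0 hR, _, uniformBall_le 0 hR⟩

/-- The centre of the travelling wave. -/
noncomputable def waveCenter (R t : ℝ) : Space :=
  (t / (volume.real (ball (0 : Space) 1) * R)) • (-(4 / 15 : ℝ) • e₃)

lemma travelingWave_eq (R t : ℝ) : travelingWave R t = uniformBall (waveCenter R t) R := rfl

lemma travelingWave_zero (R : ℝ) : travelingWave R 0 = patch R := by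
  simp [travelingWave, patch]

lemma uniformBall_map_add (a b : Space) (R : ℝ) :
    (uniformBall a R).map (· + b) = uniformBall (a + b) R := by
  refine uniformBall_map (measurePreserving_add_right volume b) ?_
  ext x
  simp [dist_eq_norm, sub_eq_add_neg, add_assoc]

theorem isTransportStokesSolution_travelingWave {R : ℝ} (hR : 0 < R) :
    IsTransportStokesSolution (patch R) (travelingWave R) where
  isProbabilityMeasure _ _ := isProbabilityMeasure_uniformBall _ hR
  bounded _ := ⟨_, fun _ _ => uniformBall_le _ hR⟩
  initial := travelingWave_zero R
  transport := by
    set q : ℝ := (volume.real (ball (0 : Space) R))⁻¹ with hq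
    have hcoord : ∀ i, IsBddLip fun x => (ballVelocity q R x - driftVelocity q R) i := fun i =>
      (isBddLip_ballVelocity (q := q) hR i).sub (.const (driftVelocity q R i))
    obtain ⟨K, hK⟩ := exists_lipschitzWith_of_coord hcoord
    obtain ⟨C, hC⟩ := exists_norm_le_of_coord hcoord
    obtain ⟨Y, hY⟩ := exists_isFlowOf hK hC
    have hvol := hY.measurePreserving hK hC fun L g hg hgc =>
      integral_fderiv_ballVelocity_sub hR _ hg hgc
    have hpre := preimage_ball_of_isFlowOf hR hY hK
    have hcenter : ∀ t, HasDerivAt (waveCenter R) (driftVelocity q R) t := by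
      intro t
      have h1 := ((hasDerivAt_id t).div_const (volume.real (ball (0 : Space) 1) * R)).smul_const
        (-(4 / 15 : ℝ) • e₃)
      refine h1.congr_deriv ?_
      have := volume_real_ball_pos
      rw [driftVelocity, smul_smul, hq, volume_real_ball R hR]
      congr 1
      field_simp
    refine ⟨fun t x => ballVelocity q R (x - waveCenter R t), fun t x => Y t x + waveCenter R t,
      fun t _ => ?_, fun x => ?_, fun t _ x => ?_, fun t _ => ?_, fun t _ => ?_⟩
    · have := (isStokesVelocity_ballVelocity hR).translate (waveCenter R t)
      rwa [patch, uniformBall_map_add, zero_add] at this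
    · simp [hY.zero, waveCenter]
    · have := ((hY.deriv t x).add (hcenter t)).hasDerivWithinAt (s := Ici 0)
      rw [sub_add_cancel] at this
      simp only [add_sub_cancel_right]
      exact this
    · exact ((hY.lipschitzWith hK t).continuous.add continuous_const).measurable
    · have h1 : (patch R).map (Y t) = patch R := uniformBall_map (hvol t) (hpre t)
      have h2 : (fun x => Y t x + waveCenter R t) = (· + waveCenter R t) ∘ Y t := rfl
      change _ = (patch R).map fun x => Y t x + waveCenter R t
      rw [h2, ← Measure.map_map (by fun_prop) (hvol t).measurable, h1, patch, uniformBall_map_add,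
        zero_add, travelingWave_eq]

/-! ### The Stokes kernel -/

/-- The `i`-th component of `|x|⁻¹ e₃ + |x|⁻³ x₃ x`, which is the velocity generated by a point
force along `e₃` up to a constant factor. The value at `0` is `0`. -/
noncomputable def kernel (i : Fin 3) (x : Space) : ℝ :=
  (if i = 2 then 1 else 0) * ‖x‖⁻¹ + x 2 * x i * ‖x‖⁻¹ ^ 3

lemma kernel_neg (i : Fin 3) (x : Space) : kernel i (-x) = kernel i x := by
  simp [kernel]

lemma kernel_smul (i : Fin 3) {c : ℝ} (hc : 0 < c) (x : Space) :
    kernel i (c • x) = c⁻¹ * kernel i x := by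
  simp only [kernel, norm_smul, Real.norm_eq_abs, abs_of_pos hc, PiLp.smul_apply, smul_eq_mul,
    mul_inv]
  field_simp

lemma measurable_kernel (i : Fin 3) : Measurable (kernel i) := by
  unfold kernel
  fun_prop

lemma abs_kernel_le (i : Fin 3) (x : Space) : |kernel i x| ≤ 2 * ‖x‖⁻¹ := by
  have hx := abs_coord_le_norm x i
  have h2 := abs_coord_le_norm x 2
  have h1 : |(if i = 2 then (1 : ℝ) else 0) * ‖x‖⁻¹| ≤ ‖x‖⁻¹ := by
    split_ifs <;> simp
  have h3 : |x 2 * x i * ‖x‖⁻¹ ^ 3| ≤ ‖x‖⁻¹ := by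
    rw [abs_mul, abs_mul, abs_of_nonneg (by positivity : 0 ≤ ‖x‖⁻¹ ^ 3)]
    calc |x 2| * |x i| * ‖x‖⁻¹ ^ 3 ≤ ‖x‖ * ‖x‖ * ‖x‖⁻¹ ^ 3 := by gcongr
      _ = ‖x‖⁻¹ := by
        rcases eq_or_ne ‖x‖ 0 with h | h
        · simp [h]
        · field_simp
  unfold kernel
  linarith [abs_add_le ((if i = 2 then (1 : ℝ) else 0) * ‖x‖⁻¹) (x 2 * x i * ‖x‖⁻¹ ^ 3)]

/-- The kernel is homogeneous of degree `-1` and smooth on the unit sphere; this is the resulting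
estimate of its increments. -/
lemma abs_kernel_sub_le (i : Fin 3) {a b : Space} (ha : a ≠ 0) (hb : b ≠ 0) :
    |kernel i a - kernel i b| ≤ 6 * ‖a - b‖ * (‖a‖⁻¹ * ‖b‖⁻¹) := by
  have hA : 0 < ‖a‖ := norm_pos_iff.2 ha
  have hB : 0 < ‖b‖ := norm_pos_iff.2 hb
  have hd : |‖b‖ - ‖a‖| ≤ ‖a - b‖ := by
    rw [norm_sub_rev]
    exact abs_norm_sub_norm_le b a
  have hinv : |‖a‖⁻¹ - ‖b‖⁻¹| ≤ ‖a - b‖ * (‖a‖⁻¹ * ‖b‖⁻¹) := by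
    have : ‖a‖⁻¹ - ‖b‖⁻¹ = (‖b‖ - ‖a‖) * (‖a‖⁻¹ * ‖b‖⁻¹) := by field_simp
    rw [this, abs_mul, abs_of_pos (by positivity : 0 < ‖a‖⁻¹ * ‖b‖⁻¹)]
    gcongr
  -- the coordinates of the directions `a / |a|` and `b / |b|`
  have hunit : ∀ (j : Fin 3) (c : Space), c ≠ 0 → |c j * ‖c‖⁻¹| ≤ 1 := by
    intro j c hc
    have hC : 0 < ‖c‖ := norm_pos_iff.2 hc
    rw [abs_mul, abs_of_pos (inv_pos.2 hC), ← div_eq_mul_inv, div_le_one hC]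
    exact abs_coord_le_norm c j
  have hdir : ∀ j : Fin 3, |a j * ‖a‖⁻¹ - b j * ‖b‖⁻¹| ≤ 2 * ‖a - b‖ * ‖a‖⁻¹ := by
    intro j
    have e : a j * ‖a‖⁻¹ - b j * ‖b‖⁻¹ =
        (a - b) j * ‖a‖⁻¹ + (b j * ‖b‖⁻¹) * ((‖b‖ - ‖a‖) * ‖a‖⁻¹) := by
      simp only [PiLp.sub_apply]
      field_simp
      ring
    rw [e]
    refine (abs_add_le _ _).trans ?_
    have t1 : |(a - b) j * ‖a‖⁻¹| ≤ ‖a - b‖ * ‖a‖⁻¹ := by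
      rw [abs_mul, abs_of_pos (inv_pos.2 hA)]
      gcongr
      exact abs_coord_le_norm _ j
    have t2 : |(b j * ‖b‖⁻¹) * ((‖b‖ - ‖a‖) * ‖a‖⁻¹)| ≤ 1 * (‖a - b‖ * ‖a‖⁻¹) := by
      rw [abs_mul, abs_mul (‖b‖ - ‖a‖), abs_of_pos (inv_pos.2 hA)]
      gcongr
      exact hunit j b hb
    linarith
  have e : kernel i a - kernel i b = (if i = 2 then (1 : ℝ) else 0) * (‖a‖⁻¹ - ‖b‖⁻¹) +
      (a 2 * ‖a‖⁻¹) * (a i * ‖a‖⁻¹) * (‖a‖⁻¹ - ‖b‖⁻¹) +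
      (a 2 * ‖a‖⁻¹) * (a i * ‖a‖⁻¹ - b i * ‖b‖⁻¹) * ‖b‖⁻¹ +
      (b i * ‖b‖⁻¹) * (a 2 * ‖a‖⁻¹ - b 2 * ‖b‖⁻¹) * ‖b‖⁻¹ := by
    simp only [kernel]
    ring
  have t1 : |(if i = 2 then (1 : ℝ) else 0) * (‖a‖⁻¹ - ‖b‖⁻¹)| ≤
      ‖a - b‖ * (‖a‖⁻¹ * ‖b‖⁻¹) := by
    refine le_trans ?_ hinv
    split_ifs <;> simp
  have t2 : |(a 2 * ‖a‖⁻¹) * (a i * ‖a‖⁻¹) * (‖a‖⁻¹ - ‖b‖⁻¹)| ≤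
      1 * 1 * (‖a - b‖ * (‖a‖⁻¹ * ‖b‖⁻¹)) := by
    rw [abs_mul, abs_mul]
    gcongr
    exacts [hunit 2 a ha, hunit i a ha]
  have t3 : |(a 2 * ‖a‖⁻¹) * (a i * ‖a‖⁻¹ - b i * ‖b‖⁻¹) * ‖b‖⁻¹| ≤
      1 * (2 * ‖a - b‖ * ‖a‖⁻¹) * ‖b‖⁻¹ := by
    rw [abs_mul, abs_mul, abs_of_pos (inv_pos.2 hB)]
    gcongr
    exacts [hunit 2 a ha, hdir i]
  have t4 : |(b i * ‖b‖⁻¹) * (a 2 * ‖a‖⁻¹ - b 2 * ‖b‖⁻¹) * ‖b‖⁻¹| ≤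
      1 * (2 * ‖a - b‖ * ‖a‖⁻¹) * ‖b‖⁻¹ := by
    rw [abs_mul, abs_mul, abs_of_pos (inv_pos.2 hB)]
    gcongr
    exacts [hunit i b hb, hdir 2]
  rw [e]
  refine (abs_add_le _ _).trans ?_
  refine (add_le_add_left ((abs_add_le _ _).trans (add_le_add_left (abs_add_le _ _) _)) _).trans ?_
  linarith

/-! ### Potential estimates for bounded densities -/

lemma integrableOn_norm_inv_sq : IntegrableOn (fun x : Space => ‖x‖⁻¹ ^ 2) (ball 0 1) := by
  rw [integrableOn_fun_norm_addHaar volume (f := fun r : ℝ => r⁻¹ ^ 2)]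
  have h : IntegrableOn (fun _ : ℝ => (1 : ℝ)) (Ioo 0 1) := integrableOn_const (by simp)
  refine h.congr_fun (fun r hr => ?_) measurableSet_Ioo
  have : r ≠ 0 := hr.1.ne'
  simp
  field_simp

/-- For a probability measure `ρ` with a density bounded by `C`, the potential
`∫ |x - y|⁻² dρ(y)` is bounded in terms of `C` alone. -/
lemma exists_integral_norm_inv_sq_le (C : ℝ≥0) : ∃ M : ℝ, 0 < M ∧ ∀ ρ : Measure Space,
    IsProbabilityMeasure ρ → ρ ≤ C • (volume : Measure Space) → ∀ x : Space,
      Integrable (fun y => ‖x - y‖⁻¹ ^ 2) ρ ∧ ∫ y, ‖x - y‖⁻¹ ^ 2 ∂ρ ≤ M := by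
  let I : ℝ := ∫ y in ball (0 : Space) 1, ‖y‖⁻¹ ^ 2
  have hI : 0 ≤ I := integral_nonneg fun y => by positivity
  refine ⟨C * I + 1, by positivity, fun ρ hρ hle x => ?_⟩
  let f : Space → ℝ := fun y => (ball (0 : Space) 1).indicator (fun y => ‖y‖⁻¹ ^ 2) (x - y)
  have hf0 : ∀ y, 0 ≤ f y := fun y => indicator_nonneg (fun y _ => by positivity) _
  have hfv : Integrable f volume :=
    ((integrable_indicator_iff measurableSet_ball).2 integrableOn_norm_inv_sq).comp_sub_left x
  have hfC : Integrable f (C • (volume : Measure Space)) := hfv.smul_measure_nnreal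
  have hfρ : Integrable f ρ := hfC.mono_measure hle
  have hbound : ∀ y, ‖x - y‖⁻¹ ^ 2 ≤ f y + 1 := by
    intro y
    by_cases h : x - y ∈ ball (0 : Space) 1
    · simp only [f, indicator_of_mem h]
      linarith
    · simp only [f, indicator_of_notMem h]
      rw [mem_ball_zero_iff, not_lt] at h
      rw [zero_add]
      exact pow_le_one₀ (by positivity) (inv_le_one_of_one_le₀ h)
  have hg : Integrable (fun y => f y + 1) ρ := hfρ.add (integrable_const 1)
  have hint : Integrable (fun y => ‖x - y‖⁻¹ ^ 2) ρ := by
    refine hg.mono' (by fun_prop) (Eventually.of_forall fun y => ?_)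
    rw [Real.norm_of_nonneg (by positivity)]
    exact hbound y
  refine ⟨hint, (integral_mono hint hg hbound).trans ?_⟩
  rw [integral_add hfρ (integrable_const 1)]
  simp only [integral_const, probReal_univ, smul_eq_mul, mul_one]
  gcongr
  calc ∫ y, f y ∂ρ ≤ ∫ y, f y ∂(C • (volume : Measure Space)) :=
        integral_mono_measure hle (Eventually.of_forall hf0) hfC
    _ = C * ∫ y, f y := by rw [integral_smul_nnreal_measure]; rfl
    _ = C * I := by
        congr 1
        rw [show I = ∫ y, (ball (0 : Space) 1).indicator (fun y => ‖y‖⁻¹ ^ 2) y from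
          (integral_indicator measurableSet_ball).symm]
        exact integral_sub_left_eq_self
          ((ball (0 : Space) 1).indicator fun y : Space => ‖y‖⁻¹ ^ 2) volume x

lemma integrable_norm_inv {ρ : Measure Space} [IsProbabilityMeasure ρ] {x : Space}
    (h : Integrable (fun y => ‖x - y‖⁻¹ ^ 2) ρ) : Integrable (fun y => ‖x - y‖⁻¹) ρ := by
  refine (h.add (integrable_const 1)).mono' (by fun_prop) (Eventually.of_forall fun y => ?_)
  rw [Real.norm_of_nonneg (by positivity)]
  simp only [Pi.add_apply]
  nlinarith [sq_nonneg (‖x - y‖⁻¹ - 1)]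

lemma integrable_kernel {ρ : Measure Space} [IsProbabilityMeasure ρ] {x : Space}
    (h : Integrable (fun y => ‖x - y‖⁻¹ ^ 2) ρ) (i : Fin 3) :
    Integrable (fun y => kernel i (x - y)) ρ := by
  refine ((integrable_norm_inv h).const_mul 2).mono'
    ((measurable_kernel i).comp (by fun_prop)).aestronglyMeasurable
    (Eventually.of_forall fun y => ?_)
  exact abs_kernel_le i _

/-! ### The representation of the Stokes velocity -/

/-- A smooth function on `ℝ³` that agrees with the norm outside the unit ball. Up to a constant
factor, the norm is the fundamental solution of the bilaplacian. -/
noncomputable def regNorm (x : Space) : ℝ :=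
  (1 - (⟨1 / 2, 1, by norm_num, by norm_num⟩ : ContDiffBump (0 : Space)) x) * ‖x‖

lemma contDiff_regNorm : ContDiff ℝ ∞ regNorm := by
  rw [contDiff_iff_contDiffAt]
  intro x
  by_cases hx : x = 0
  · subst hx
    have : regNorm =ᶠ[𝓝 0] fun _ => 0 := by
      filter_upwards [closedBall_mem_nhds (0 : Space) (by norm_num : (0 : ℝ) < 1 / 2)] with y hy
      rw [regNorm, ContDiffBump.one_of_mem_closedBall _ hy]
      ring
    exact contDiffAt_const.congr_of_eventuallyEq this
  · exact (contDiffAt_const.sub (ContDiffBump.contDiff _).contDiffAt).mul (contDiffAt_norm ℝ hx)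

lemma regNorm_eq {x : Space} (hx : 1 ≤ ‖x‖) : regNorm x = ‖x‖ := by
  rw [regNorm, ContDiffBump.zero_of_le_dist _ (by simpa using hx)]
  ring

lemma pd_eq_of_hasLineDerivAt {f g : Space → ℝ} {d : ℝ} {x : Space} {i : Fin 3}
    (hf : ContDiff ℝ ∞ f) (hfg : ∀ y : Space, 1 < ‖y‖ → f y = g y) (hx : 1 < ‖x‖)
    (hg : HasLineDerivAt ℝ g d x (unitVec i)) : pd i f x = d := by
  have hev : f =ᶠ[𝓝 x] g := by
    filter_upwards [continuous_norm.continuousAt.eventually_const_lt hx] with y hy using hfg y hy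
  rw [pd, ← (differentiable_of_smooth hf x).lineDeriv_eq_fderiv, hev.lineDeriv_eq, hg.lineDeriv]

section outside

variable {x : Space}

lemma pd_regNorm (hx : 1 < ‖x‖) (i : Fin 3) : pd i regNorm x = x i * ‖x‖⁻¹ := by
  have h0 : x ≠ 0 := norm_pos_iff.1 (one_pos.trans hx)
  have hr : 0 < ‖x‖ := norm_pos_iff.2 h0
  refine pd_eq_of_hasLineDerivAt (g := fun y => ‖y‖⁻¹⁻¹) contDiff_regNorm
    (fun y hy => by rw [regNorm_eq hy.le, inv_inv]) hx ?_
  have h := (hasLineDerivAt_inv_norm h0 i).inv (by simpa using hr.ne')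
  simp only [zero_smul, add_zero] at h
  refine HasDerivAt.congr_deriv h ?_
  field_simp

lemma pd_pd_regNorm (hx : 1 < ‖x‖) (i j : Fin 3) :
    pd j (pd i regNorm) x = (if i = j then 1 else 0) * ‖x‖⁻¹ - x i * x j * ‖x‖⁻¹ ^ 3 := by
  have h0 : x ≠ 0 := norm_pos_iff.1 (one_pos.trans hx)
  refine pd_eq_of_hasLineDerivAt (contDiff_pd contDiff_regNorm i)
    (fun y hy => pd_regNorm hy i) hx ?_
  have h := (hasLineDerivAt_coord x i j).mul (hasLineDerivAt_inv_norm h0 j)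
  simp only [zero_smul, add_zero] at h
  refine HasDerivAt.congr_deriv h ?_
  ring

lemma lap_regNorm (hx : 1 < ‖x‖) : lap regNorm x = 2 * ‖x‖⁻¹ := by
  have hr : 0 < ‖x‖ := one_pos.trans hx
  have hn := norm_sq_eq_sum x
  simp only [lap, pd_pd_regNorm hx, Fin.sum_univ_three, if_true]
  have : ‖x‖⁻¹ = ‖x‖ ^ 2 * ‖x‖⁻¹ ^ 3 := by field_simp
  rw [hn] at this
  linear_combination this

lemma pd_lap_regNorm (hx : 1 < ‖x‖) (i : Fin 3) :
    pd i (lap regNorm) x = -2 * (x i * ‖x‖⁻¹ ^ 3) := by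
  have h0 : x ≠ 0 := norm_pos_iff.1 (one_pos.trans hx)
  refine pd_eq_of_hasLineDerivAt (contDiff_lap contDiff_regNorm)
    (fun y hy => lap_regNorm hy) hx ?_
  refine HasDerivAt.congr_deriv ((hasLineDerivAt_inv_norm h0 i).const_mul 2) ?_
  ring

lemma pd_pd_lap_regNorm (hx : 1 < ‖x‖) (i : Fin 3) :
    pd i (pd i (lap regNorm)) x = -2 * (‖x‖⁻¹ ^ 3 - 3 * x i ^ 2 * ‖x‖⁻¹ ^ 5) := by
  have h0 : x ≠ 0 := norm_pos_iff.1 (one_pos.trans hx)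
  refine pd_eq_of_hasLineDerivAt (contDiff_pd (contDiff_lap contDiff_regNorm) i)
    (fun y hy => pd_lap_regNorm hy i) hx ?_
  have h := ((hasLineDerivAt_coord x i i).mul
    ((hasLineDerivAt_inv_norm h0 i).pow 3)).const_mul (-2)
  simp only [zero_smul, add_zero, if_true] at h
  refine HasDerivAt.congr_deriv h ?_
  simp
  ring

lemma lap_lap_regNorm (hx : 1 < ‖x‖) : lap (lap regNorm) x = 0 := by
  have hr : 0 < ‖x‖ := one_pos.trans hx
  have hn := norm_sq_eq_sum x
  have : ‖x‖⁻¹ ^ 3 = ‖x‖ ^ 2 * ‖x‖⁻¹ ^ 5 := by field_simp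
  rw [hn] at this
  rw [lap]
  simp only [pd_pd_lap_regNorm hx, Fin.sum_univ_three]
  linear_combination -6 * this

end outside

lemma hasCompactSupport_bilaplacian : HasCompactSupport (lap (lap regNorm)) :=
  HasCompactSupport.intro (isCompact_closedBall (0 : Space) 1) fun x hx =>
    lap_lap_regNorm (by simpa using hx)

/-- The second order operator `δᵢ₃ Δ - ∂₃∂ᵢ`, which maps a multiple of the fundamental solution of
the bilaplacian to the `i`-th component of the Stokes kernel. -/
noncomputable def stokesOp (i : Fin 3) (f : Space → ℝ) (x : Space) : ℝ :=
  (if i = 2 then lap f x else 0) - pd 2 (pd i f) x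

lemma contDiff_ite_lap {f : Space → ℝ} (hf : ContDiff ℝ ∞ f) (i j : Fin 3) :
    ContDiff ℝ ∞ (fun y => if j = i then lap f y else 0) := by
  split_ifs
  · exact contDiff_lap hf
  · exact contDiff_const

lemma continuous_stokesOp {f : Space → ℝ} (hf : ContDiff ℝ ∞ f) (i : Fin 3) :
    Continuous (stokesOp i f) :=
  ((contDiff_ite_lap hf 2 i).sub (contDiff_pd (contDiff_pd hf i) 2)).continuous

lemma stokesOp_regNorm {x : Space} (hx : 1 < ‖x‖) (i : Fin 3) :
    stokesOp i regNorm x = kernel i x := by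
  rw [stokesOp, lap_regNorm hx, pd_pd_regNorm hx, kernel]
  split_ifs <;> ring

lemma pd_zero (i : Fin 3) : pd i (fun _ => 0) = fun _ => 0 := by
  funext x
  simp [pd]

lemma tsupport_pd_subset {f : Space → ℝ} {s : Set Space} (hf : tsupport f ⊆ s) (i : Fin 3) :
    tsupport (pd i f) ⊆ s :=
  (tsupport_fderiv_apply_subset ℝ (unitVec i)).trans hf

/-- The Stokes equations tested with the divergence free field `Δψ eᵢ - ∇∂ᵢψ`. -/
lemma IsStokesVelocity.integral_mul_bilaplacian {ρ : Measure Space} {u : Space → Space}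
    (h : IsStokesVelocity ρ u) {ψ : Space → ℝ} (hψ : ContDiff ℝ ∞ ψ) (hc : HasCompactSupport ψ)
    (i : Fin 3) : ∫ x, u x i * lap (lap ψ) x = ∫ x, stokesOp i ψ x ∂ρ := by
  obtain ⟨p, -, hmom⟩ := h.momentum
  have hlap := contDiff_lap hψ
  have hpi := contDiff_pd hψ i
  let φ : Space → Space := fun y =>
    WithLp.toLp 2 fun j => (if j = i then lap ψ y else 0) - pd j (pd i ψ) y
  have hφj : ∀ j, (fun y => φ y j) =
      fun y => (if j = i then lap ψ y else 0) - pd j (pd i ψ) y := fun j => rfl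
  have hφ : ContDiff ℝ ∞ φ := contDiff_euclidean.2 fun j =>
    (contDiff_ite_lap hψ i j).sub (contDiff_pd hpi j)
  have hφc : HasCompactSupport φ := by
    refine HasCompactSupport.intro hc fun x hx => ?_
    have hz : ∀ j k, pd j (pd k ψ) x = 0 := fun j k => image_eq_zero_of_notMem_tsupport fun h' =>
      hx (tsupport_pd_subset (tsupport_pd_subset subset_rfl k) j h')
    ext j
    simp [φ, lap, hz]
  have hdiv : ∀ x, divergence φ x = 0 := by
    intro x
    rw [divergence_eq hφ]
    simp only [hφj]
    have h1 : ∀ j, pd j (fun y => (if j = i then lap ψ y else 0) - pd j (pd i ψ) y) x =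
        (if j = i then pd i (lap ψ) x else 0) - pd j (pd j (pd i ψ)) x := by
      intro j
      rw [pd_sub (contDiff_ite_lap hψ i j) (contDiff_pd hpi j)]
      congr 1
      split_ifs with hji
      · rw [hji]
      · simp [pd_zero]
    simp only [h1, Finset.sum_sub_distrib, Finset.sum_ite_eq', Finset.mem_univ, if_true]
    rw [pd_lap hψ, lap, sub_self]
  have hinner : ∀ x, ⟪u x, (Laplacian.laplacian φ : Space → Space) x⟫_ℝ =
      u x i * lap (lap ψ) x - ⟪u x, gradient (lap (pd i ψ)) x⟫_ℝ := by
    intro x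
    rw [inner_eq_sum, inner_gradient]
    have h1 : ∀ j, (Laplacian.laplacian φ : Space → Space) x j =
        (if j = i then lap (lap ψ) x else 0) - pd j (lap (pd i ψ)) x := by
      intro j
      rw [laplacian_coord hφ, hφj, lap_sub (contDiff_ite_lap hψ i j) (contDiff_pd hpi j),
        pd_lap hpi]
      congr 1
      split_ifs with hji
      · rfl
      · simp [lap, pd_zero]
    simp only [h1, mul_sub, Finset.sum_sub_distrib, mul_ite, mul_zero, Finset.sum_ite_eq',
      Finset.mem_univ, if_true]
  have hcont : ∀ j, Continuous fun x => u x j := fun j =>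
    (continuous_apply j).comp ((PiLp.continuous_ofLp 2 _).comp h.continuous)
  have hgrad : Integrable fun x => ⟪u x, gradient (lap (pd i ψ)) x⟫_ℝ := by
    simp only [inner_gradient]
    exact integrable_finsetSum _ fun j _ => integrable_mul_of_compactSupport (hcont j)
      (contDiff_pd (contDiff_lap hpi) j).continuous
      (hasCompactSupport_pd (hasCompactSupport_lap (hasCompactSupport_pd hc i)) j)
  have h1 := hmom φ hφ hφc
  simp only [hdiv, hinner, mul_zero, integral_zero, sub_zero] at h1
  rw [integral_sub (integrable_mul_of_compactSupport (hcont i) (contDiff_lap hlap).continuous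
      (hasCompactSupport_lap (hasCompactSupport_lap hc))) hgrad,
    h.div_eq_zero _ (contDiff_lap hpi) (hasCompactSupport_lap (hasCompactSupport_pd hc i)),
    sub_zero, neg_inj] at h1
  rw [h1]
  refine integral_congr_ae (Eventually.of_forall fun x => ?_)
  simp [e₃_eq, inner_unitVec, φ, stokesOp, eq_comm (a := i)]

/-- The dilation `l F((y - x) / l)` of a function about the point `x`. -/
noncomputable def dilate (x : Space) (l : ℝ) (f : Space → ℝ) (y : Space) : ℝ :=
  l * f (l⁻¹ • (y - x))

section dilate

variable {f : Space → ℝ} {l : ℝ} (x : Space)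

lemma contDiff_dilate (hf : ContDiff ℝ ∞ f) : ContDiff ℝ ∞ (dilate x l f) :=
  contDiff_const.mul (contDiff_comp_affine hf _ _)

lemma lap_dilate (hl : l ≠ 0) (hf : ContDiff ℝ ∞ f) (y : Space) :
    lap (dilate x l f) y = l⁻¹ * lap f (l⁻¹ • (y - x)) := by
  change lap (fun y => l * f (l⁻¹ • (y - x))) y = _
  rw [lap_const_mul _ (contDiff_comp_affine hf _ _), lap_comp_affine hf]
  field_simp

lemma lap_lap_dilate (hl : l ≠ 0) (hf : ContDiff ℝ ∞ f) (y : Space) :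
    lap (lap (dilate x l f)) y = l⁻¹ ^ 3 * lap (lap f) (l⁻¹ • (y - x)) := by
  rw [show lap (dilate x l f) = fun y => l⁻¹ * lap f (l⁻¹ • (y - x)) from
    funext fun y => lap_dilate x hl hf y, lap_const_mul _ (contDiff_comp_affine
      (contDiff_lap hf) _ _), lap_comp_affine (contDiff_lap hf)]
  ring

lemma stokesOp_dilate (hl : l ≠ 0) (hf : ContDiff ℝ ∞ f) (i : Fin 3) (y : Space) :
    stokesOp i (dilate x l f) y = l⁻¹ * stokesOp i f (l⁻¹ • (y - x)) := by
  have h1 : pd i (dilate x l f) = fun y => pd i f (l⁻¹ • (y - x)) := by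
    funext y
    change pd i (fun y => l * f (l⁻¹ • (y - x))) y = _
    rw [pd_const_mul _ (contDiff_comp_affine hf _ _), pd_comp_affine hf]
    field_simp
  rw [stokesOp, stokesOp, lap_dilate x hl hf, h1, pd_comp_affine (contDiff_pd hf i)]
  split_ifs <;> ring

end dilate

lemma stokesOp_sub {f g : Space → ℝ} (hf : ContDiff ℝ ∞ f) (hg : ContDiff ℝ ∞ g) (i : Fin 3)
    (x : Space) : stokesOp i (fun y => f y - g y) x = stokesOp i f x - stokesOp i g x := by
  rw [stokesOp, stokesOp, stokesOp, lap_sub hf hg, show pd i (fun y => f y - g y) =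
    fun y => pd i f y - pd i g y from funext fun y => pd_sub hf hg i y,
    pd_sub (contDiff_pd hf i) (contDiff_pd hg i)]
  split_ifs <;> ring

lemma exists_norm_mul_stokesOp_le (i : Fin 3) :
    ∃ C : ℝ, ∀ z, |stokesOp i regNorm z| ≤ C ∧ ‖z‖ * |stokesOp i regNorm z| ≤ C := by
  obtain ⟨C, hC⟩ := (isCompact_closedBall (0 : Space) 1).exists_bound_of_continuousOn
    (continuous_stokesOp contDiff_regNorm i).continuousOn
  refine ⟨max C 2, fun z => ?_⟩
  rcases le_or_gt ‖z‖ 1 with h | h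
  · have h1 := hC z (by simpa using h)
    rw [Real.norm_eq_abs] at h1
    have h2 : ‖z‖ * |stokesOp i regNorm z| ≤ 1 * |stokesOp i regNorm z| := by gcongr
    exact ⟨h1.trans (le_max_left _ _), h2.trans (by rw [one_mul]; exact h1.trans (le_max_left _ _))⟩
  · rw [stokesOp_regNorm h]
    have hr : 0 < ‖z‖ := one_pos.trans h
    have h1 := abs_kernel_le i z
    have h2 : ‖z‖ * |kernel i z| ≤ 2 := by
      calc ‖z‖ * |kernel i z| ≤ ‖z‖ * (2 * ‖z‖⁻¹) := by gcongr
        _ = 2 := by field_simp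
    refine ⟨(h1.trans ?_).trans (le_max_right _ _), h2.trans (le_max_right _ _)⟩
    have := inv_le_one_of_one_le₀ h.le
    linarith

lemma exists_norm_le_of_tendsto_zero {u : Space → Space} (hu : Continuous u)
    (h0 : Tendsto u (cocompact Space) (𝓝 0)) : ∃ C : ℝ, ∀ x, ‖u x‖ ≤ C := by
  obtain ⟨C, hC⟩ := ZeroAtInftyContinuousMap.bounded
    (⟨⟨u, hu⟩, h0⟩ : ZeroAtInftyContinuousMap Space Space)
  refine ⟨C + ‖u 0‖, fun x => ?_⟩
  have := hC x 0
  change dist (u x) (u 0) ≤ C at this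
  rw [dist_eq_norm] at this
  calc ‖u x‖ = ‖(u x - u 0) + u 0‖ := by rw [sub_add_cancel]
    _ ≤ ‖u x - u 0‖ + ‖u 0‖ := norm_add_le _ _
    _ ≤ C + ‖u 0‖ := by gcongr

section limits

variable {g k : Space → ℝ}

lemma integral_mul_dilate (x : Space) {l : ℝ} (hl : 0 < l) :
    ∫ y, g y * (l⁻¹ ^ 3 * k (l⁻¹ • (y - x))) = ∫ z, g (x + l • z) * k z := by
  have h1 := Measure.integral_comp_smul (volume : Measure Space)
    (fun y => g (x + y) * k (l⁻¹ • y)) l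
  have h2 := integral_sub_right_eq_self (μ := (volume : Measure Space))
    (fun y => g (x + y) * (l⁻¹ ^ 3 * k (l⁻¹ • y))) x
  simp only [add_sub_cancel] at h2
  rw [h2]
  simp only [smul_smul, inv_mul_cancel₀ hl.ne', one_smul] at h1
  rw [h1, ← integral_smul]
  refine integral_congr_ae (Eventually.of_forall fun y => ?_)
  have : |(l ^ Module.finrank ℝ Space)⁻¹| = l⁻¹ ^ 3 := by
    rw [finrank_euclideanSpace_fin, abs_of_pos (by positivity), inv_pow]
  simp only [this, smul_eq_mul]
  ring

variable {C : ℝ}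

lemma tendsto_integral_dilate_atTop (hg : Continuous g) (hgC : ∀ x, |g x| ≤ C)
    (hg0 : Tendsto g (cocompact Space) (𝓝 0)) (hk : Continuous k) (hkc : HasCompactSupport k)
    (x : Space) : Tendsto (fun l : ℝ => ∫ z, g (x + l • z) * k z) atTop (𝓝 0) := by
  have hki : Integrable k := hk.integrable_of_hasCompactSupport hkc
  have h := tendsto_integral_filter_of_dominated_convergence (l := atTop)
    (μ := (volume : Measure Space)) (F := fun (l : ℝ) z => g (x + l • z) * k z)
    (f := fun _ => 0) (fun z => C * |k z|)
    (Eventually.of_forall fun l => ((hg.comp (by fun_prop)).mul hk).aestronglyMeasurable)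
    (Eventually.of_forall fun l => Eventually.of_forall fun z => by
      rw [norm_mul]
      exact mul_le_mul_of_nonneg_right (hgC _) (abs_nonneg _))
    (hki.abs.const_mul C) ?_
  · simpa using h
  · have hne : ∀ᵐ z : Space, z ≠ 0 := by simp [ae_iff]
    filter_upwards [hne] with z hz
    have hz' : 0 < ‖z‖ := norm_pos_iff.2 hz
    have h1 : Tendsto (fun l : ℝ => x + l • z) atTop (cocompact Space) := by
      rw [← cobounded_eq_cocompact, ← comap_norm_atTop, tendsto_comap_iff]
      refine tendsto_atTop_mono (f := fun l : ℝ => l * ‖z‖ - ‖x‖) (fun l => ?_)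
        (tendsto_atTop_add_const_right _ _ (tendsto_id.atTop_mul_const hz'))
      have h2 : ‖l • z‖ ≤ ‖x + l • z‖ + ‖x‖ := by
        calc ‖l • z‖ = ‖(x + l • z) - x‖ := by rw [add_sub_cancel_left]
          _ ≤ _ := norm_sub_le _ _
      have h3 : l * ‖z‖ ≤ ‖l • z‖ := by
        rw [norm_smul]
        gcongr
        exact le_abs_self l
      simp only [Function.comp_apply]
      linarith
    simpa using (hg0.comp h1).mul_const (k z)

lemma tendsto_integral_dilate_zero (hg : Continuous g) (hgC : ∀ x, |g x| ≤ C)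
    (hk : Continuous k) (hkc : HasCompactSupport k) (x : Space) :
    Tendsto (fun l : ℝ => ∫ z, g (x + l • z) * k z) (𝓝[>] 0) (𝓝 (g x * ∫ z, k z)) := by
  have hki : Integrable k := hk.integrable_of_hasCompactSupport hkc
  rw [← integral_const_mul]
  refine tendsto_integral_filter_of_dominated_convergence (fun z => C * |k z|)
    (Eventually.of_forall fun l => ((hg.comp (by fun_prop)).mul hk).aestronglyMeasurable)
    (Eventually.of_forall fun l => Eventually.of_forall fun z => by
      rw [norm_mul]
      exact mul_le_mul_of_nonneg_right (hgC _) (abs_nonneg _))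
    (hki.abs.const_mul C) (Eventually.of_forall fun z => ?_)
  refine Tendsto.mul_const _ ?_
  have hc : Continuous fun l : ℝ => g (x + l • z) := hg.comp (by fun_prop)
  have := (hc.tendsto 0).mono_left (nhdsWithin_le_nhds (s := Ioi 0))
  simpa using this

end limits

lemma ae_ne_of_le {ρ : Measure Space} {C : ℝ≥0} (h : ρ ≤ C • (volume : Measure Space))
    (x : Space) : ∀ᵐ y ∂ρ, y ≠ x := by
  have h1 : ρ ≪ (volume : Measure Space) :=
    (Measure.absolutelyContinuous_of_le h).trans (Measure.smul_absolutelyContinuous)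
  have h2 : ∀ᵐ y : Space, y ≠ x := by simp [ae_iff]
  exact h1.ae_le h2

lemma tendsto_integral_stokesOp_atTop {ρ : Measure Space} [IsProbabilityMeasure ρ] (x : Space)
    (i : Fin 3) : Tendsto (fun l : ℝ => ∫ y, l⁻¹ * stokesOp i regNorm (l⁻¹ • (y - x)) ∂ρ) atTop
      (𝓝 0) := by
  obtain ⟨C, hC⟩ := exists_norm_mul_stokesOp_le i
  have h1 : Tendsto (fun l : ℝ => l⁻¹ * C) atTop (𝓝 0) := by
    simpa using tendsto_inv_atTop_zero.mul_const C
  refine squeeze_zero_norm' ?_ h1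
  filter_upwards [eventually_gt_atTop 0] with l hl
  refine (norm_integral_le_of_norm_le_const (C := l⁻¹ * C) (Eventually.of_forall fun y => ?_)).trans
    (by simp)
  rw [norm_mul, Real.norm_of_nonneg (by positivity)]
  gcongr
  exact (hC _).1

lemma tendsto_integral_stokesOp_zero {ρ : Measure Space} [IsProbabilityMeasure ρ] {C : ℝ≥0}
    (hρ : ρ ≤ C • (volume : Measure Space)) (x : Space) (i : Fin 3) :
    Tendsto (fun l : ℝ => ∫ y, l⁻¹ * stokesOp i regNorm (l⁻¹ • (y - x)) ∂ρ) (𝓝[>] 0)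
      (𝓝 (∫ y, kernel i (x - y) ∂ρ)) := by
  obtain ⟨B, hB⟩ := exists_norm_mul_stokesOp_le i
  obtain ⟨M, -, hM⟩ := exists_integral_norm_inv_sq_le C
  have hinv := integrable_norm_inv (hM ρ inferInstance hρ x).1
  refine tendsto_integral_filter_of_dominated_convergence (fun y => B * ‖x - y‖⁻¹)
    (Eventually.of_forall fun l => (continuous_const.mul ((continuous_stokesOp contDiff_regNorm
      i).comp (by fun_prop))).aestronglyMeasurable)
    ?_ (hinv.const_mul B) ?_
  · filter_upwards [self_mem_nhdsWithin] with l hl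
    have hl : 0 < l := hl
    filter_upwards [ae_ne_of_le hρ x] with y hy
    have hr : 0 < ‖y - x‖ := norm_pos_iff.2 (sub_ne_zero.2 hy)
    have h := (hB (l⁻¹ • (y - x))).2
    rw [norm_smul, Real.norm_of_nonneg (by positivity : 0 ≤ l⁻¹)] at h
    rw [norm_mul, Real.norm_of_nonneg (by positivity : 0 ≤ l⁻¹), norm_sub_rev,
      ← div_eq_mul_inv, le_div_iff₀ hr, Real.norm_eq_abs]
    linarith
  · filter_upwards [ae_ne_of_le hρ x] with y hy
    have hr : 0 < ‖y - x‖ := norm_pos_iff.2 (sub_ne_zero.2 hy)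
    refine tendsto_const_nhds.congr' ?_
    filter_upwards [Ioo_mem_nhdsGT hr] with l hl
    have hl0 : 0 < l⁻¹ := inv_pos.2 hl.1
    have h1 : 1 < ‖l⁻¹ • (y - x)‖ := by
      rw [norm_smul, Real.norm_of_nonneg hl0.le, ← div_eq_inv_mul, one_lt_div hl.1]
      exact hl.2
    rw [stokesOp_regNorm h1, kernel_smul i hl0, ← kernel_neg, neg_sub, inv_inv]
    have := hl.1.ne'
    field_simp

/-- A Stokes velocity is, up to a constant factor, the convolution of the density with the Stokes
kernel. The momentum equation is tested with the dilations `l F((y - x) / l)` of the regularized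
norm `F`, truncated by subtracting another dilation; then `l → ∞` uses the decay of `u`, and
`l → 0` its continuity. The constant is the integral of `Δ²F`. -/
theorem IsStokesVelocity.mul_eq_integral_kernel {ρ : Measure Space} [IsProbabilityMeasure ρ]
    {C : ℝ≥0} (hρ : ρ ≤ C • (volume : Measure Space)) {u : Space → Space}
    (h : IsStokesVelocity ρ u) (x : Space) (i : Fin 3) :
    u x i * (∫ z, lap (lap regNorm) z) = ∫ y, kernel i (x - y) ∂ρ := by
  have hF := contDiff_regNorm
  have hk : Continuous (lap (lap regNorm)) := (contDiff_lap (contDiff_lap hF)).continuous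
  have hkc := hasCompactSupport_bilaplacian
  have hcont : Continuous fun x => u x i :=
    (continuous_apply i).comp ((PiLp.continuous_ofLp 2 _).comp h.continuous)
  obtain ⟨B, hB⟩ := exists_norm_le_of_tendsto_zero h.continuous h.tendsto_zero
  have huB : ∀ x, |u x i| ≤ B := fun x => (abs_coord_le_norm _ i).trans (hB x)
  have hu0 : Tendsto (fun x => u x i) (cocompact Space) (𝓝 0) := by
    have := (((continuous_apply i).comp (PiLp.continuous_ofLp 2 fun _ : Fin 3 => ℝ)).tendsto
      0).comp h.tendsto_zero
    simpa [Function.comp_def] using this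
  let a : ℝ → ℝ := fun l => ∫ z, u (x + l • z) i * lap (lap regNorm) z
  let b : ℝ → ℝ := fun l => ∫ y, l⁻¹ * stokesOp i regNorm (l⁻¹ • (y - x)) ∂ρ
  have hab : ∀ l r : ℝ, 0 < l → 0 < r → a l - a r = b l - b r := by
    intro l r hl hr
    have hl' := contDiff_dilate x (l := l) hF
    have hr' := contDiff_dilate x (l := r) hF
    have hout : ∀ s : ℝ, 0 < s → ∀ y : Space, s ≤ ‖y - x‖ → dilate x s regNorm y = ‖y - x‖ := by
      intro s hs y hy
      have h1 : ‖s⁻¹ • (y - x)‖ = s⁻¹ * ‖y - x‖ := by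
        rw [norm_smul, Real.norm_of_nonneg (inv_pos.2 hs).le]
      rw [dilate, regNorm_eq (by rwa [h1, ← div_eq_inv_mul, one_le_div hs]), h1]
      field_simp
    have hsupp : HasCompactSupport fun y => dilate x l regNorm y - dilate x r regNorm y := by
      refine HasCompactSupport.intro (isCompact_closedBall x (max l r)) fun y hy => ?_
      rw [mem_closedBall, not_le, dist_eq_norm] at hy
      rw [hout l hl y ((le_max_left _ _).trans hy.le), hout r hr y ((le_max_right _ _).trans hy.le),
        sub_self]
    have h1 := h.integral_mul_bilaplacian (hl'.sub hr') hsupp i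
    have h2 : ∀ y, lap (lap fun y => dilate x l regNorm y - dilate x r regNorm y) y =
        l⁻¹ ^ 3 * lap (lap regNorm) (l⁻¹ • (y - x)) -
          r⁻¹ ^ 3 * lap (lap regNorm) (r⁻¹ • (y - x)) := by
      intro y
      rw [show lap (fun y => dilate x l regNorm y - dilate x r regNorm y) =
        fun y => lap (dilate x l regNorm) y - lap (dilate x r regNorm) y from
        funext fun y => lap_sub hl' hr' y, lap_sub (contDiff_lap hl') (contDiff_lap hr'),
        lap_lap_dilate x hl.ne' hF, lap_lap_dilate x hr.ne' hF]
    have h3 : ∀ y, stokesOp i (fun y => dilate x l regNorm y - dilate x r regNorm y) y =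
        l⁻¹ * stokesOp i regNorm (l⁻¹ • (y - x)) - r⁻¹ * stokesOp i regNorm (r⁻¹ • (y - x)) := by
      intro y
      rw [stokesOp_sub hl' hr', stokesOp_dilate x hl.ne' hF, stokesOp_dilate x hr.ne' hF]
    have h4 : ∀ s : ℝ, 0 < s →
        Integrable fun y => u y i * (s⁻¹ ^ 3 * lap (lap regNorm) (s⁻¹ • (y - x))) := by
      intro s hs
      refine integrable_mul_of_compactSupport hcont
        (continuous_const.mul (hk.comp (by fun_prop))) (HasCompactSupport.mul_left ?_)
      exact hkc.comp_homeomorph ((Homeomorph.subRight x).trans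
        (Homeomorph.smulOfNeZero s⁻¹ (inv_ne_zero hs.ne')))
    have h5 : ∀ s : ℝ, Integrable (fun y => s⁻¹ * stokesOp i regNorm (s⁻¹ • (y - x))) ρ := by
      intro s
      obtain ⟨D, hD⟩ := exists_norm_mul_stokesOp_le i
      refine (Integrable.of_bound (((continuous_stokesOp hF i).comp
        (by fun_prop)).aestronglyMeasurable) D (Eventually.of_forall fun y => ?_)).const_mul _
      exact (hD _).1
    simp only [h2, h3, mul_sub] at h1
    rw [integral_sub (h4 l hl) (h4 r hr), integral_sub (h5 l) (h5 r),
      integral_mul_dilate (g := fun y => u y i) x hl,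
      integral_mul_dilate (g := fun y => u y i) x hr] at h1
    exact h1
  have ha : ∀ l, 0 < l → a l = b l := by
    intro l hl
    have l1 := tendsto_integral_dilate_atTop hcont huB hu0 hk hkc x
    have l2 := tendsto_integral_stokesOp_atTop (ρ := ρ) x i
    have l3 : Tendsto (fun r => a r - b r) atTop (𝓝 (a l - b l)) := by
      refine tendsto_const_nhds.congr' ?_
      filter_upwards [eventually_gt_atTop 0] with r hr
      linarith [hab l r hl hr]
    have := tendsto_nhds_unique l3 (l1.sub l2)
    linarith
  refine tendsto_nhds_unique (tendsto_integral_dilate_zero hcont huB hk hkc x) ?_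
  refine (tendsto_integral_stokesOp_zero hρ x i).congr' ?_
  filter_upwards [self_mem_nhdsWithin] with l hl
  exact (ha l hl).symm

lemma kernel_two_nonneg (x : Space) : 0 ≤ kernel 2 x := by
  simp only [kernel, if_true, one_mul]
  have := mul_self_nonneg (x 2)
  positivity

lemma kernel_two_pos {x : Space} (hx : x ≠ 0) : 0 < kernel 2 x := by
  have hr : 0 < ‖x‖ := norm_pos_iff.2 hx
  simp only [kernel, if_true, one_mul]
  have := mul_self_nonneg (x 2)
  positivity

/-- The constant in the representation formula does not vanish, since the velocity at the centre of
a ball is represented by the integral of a positive function. -/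
lemma integral_bilaplacian_ne_zero : ∫ z, lap (lap regNorm) z ≠ 0 := by
  intro h0
  have hp : IsProbabilityMeasure (patch 1) := isProbabilityMeasure_uniformBall 0 one_pos
  have hle : patch 1 ≤ _ := uniformBall_le 0 one_pos
  have h := (isStokesVelocity_ballVelocity one_pos).mul_eq_integral_kernel hle 0 2
  rw [h0, mul_zero] at h
  obtain ⟨M, -, hM⟩ := exists_integral_norm_inv_sq_le
    ((volume (ball (0 : Space) 1))⁻¹.toNNReal)
  have hint := integrable_kernel (hM _ hp hle 0).1 2
  have h1 := (integral_eq_zero_iff_of_nonneg (fun y => kernel_two_nonneg _) hint).1 h.symm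
  have h2 : ∀ᵐ y ∂(patch 1), False := by
    filter_upwards [h1, ae_ne_of_le hle 0] with y hy hy0
    exact (kernel_two_pos (by simpa using hy0)).ne' hy
  simp at h2
  exact hp.ne_zero _ h2

/-! ### Uniqueness of solutions -/

/-- Stability of the potential `∫ K(x - y) dρ(y)` under simultaneous perturbation of the point and,
along a transport map, of the density. -/
lemma abs_integral_kernel_sub_le {C : ℝ≥0} {M : ℝ}
    (hM : ∀ ρ : Measure Space, IsProbabilityMeasure ρ → ρ ≤ C • (volume : Measure Space) →
      ∀ x : Space, Integrable (fun y => ‖x - y‖⁻¹ ^ 2) ρ ∧ ∫ y, ‖x - y‖⁻¹ ^ 2 ∂ρ ≤ M)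
    {ρ₀ : Measure Space} [IsProbabilityMeasure ρ₀] {S T : Space → Space} (hS : Measurable S)
    (hT : Measurable T) (hSC : ρ₀.map S ≤ C • (volume : Measure Space))
    (hTC : ρ₀.map T ≤ C • (volume : Measure Space)) {A : ℝ} (hA : ∀ y, ‖S y - T y‖ ≤ A)
    (x x' : Space) (i : Fin 3) :
    |∫ y, kernel i (x - y) ∂(ρ₀.map S) - ∫ y, kernel i (x' - y) ∂(ρ₀.map T)| ≤
      6 * (‖x - x'‖ + A) * M := by
  have hSp : IsProbabilityMeasure (ρ₀.map S) := Measure.isProbabilityMeasure_map hS.aemeasurable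
  have hTp : IsProbabilityMeasure (ρ₀.map T) := Measure.isProbabilityMeasure_map hT.aemeasurable
  obtain ⟨iS, bS⟩ := hM _ hSp hSC x
  obtain ⟨iT, bT⟩ := hM _ hTp hTC x'
  have hA0 : 0 ≤ A := (norm_nonneg _).trans (hA 0)
  have kS := integrable_kernel iS i
  have kT := integrable_kernel iT i
  have hmk : ∀ z : Space, Measurable fun y => kernel i (z - y) := fun z =>
    (measurable_kernel i).comp (by fun_prop)
  have hmn : ∀ z : Space, Measurable fun y : Space => ‖z - y‖⁻¹ ^ 2 := fun z => by fun_prop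
  rw [integral_map hS.aemeasurable (hmk x).aestronglyMeasurable,
    integral_map hT.aemeasurable (hmk x').aestronglyMeasurable]
  rw [integrable_map_measure (hmk x).aestronglyMeasurable hS.aemeasurable] at kS
  rw [integrable_map_measure (hmk x').aestronglyMeasurable hT.aemeasurable] at kT
  rw [integral_map hS.aemeasurable (hmn x).aestronglyMeasurable] at bS
  rw [integral_map hT.aemeasurable (hmn x').aestronglyMeasurable] at bT
  rw [integrable_map_measure (hmn x).aestronglyMeasurable hS.aemeasurable] at iS
  rw [integrable_map_measure (hmn x').aestronglyMeasurable hT.aemeasurable] at iT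
  simp only [Function.comp_def] at kS kT iS iT
  rw [← integral_sub kS kT]
  have hneS := ae_of_ae_map hS.aemeasurable (ae_ne_of_le hSC x)
  have hneT := ae_of_ae_map hT.aemeasurable (ae_ne_of_le hTC x')
  rw [← Real.norm_eq_abs]
  refine (norm_integral_le_of_norm_le (((iS.add iT).const_mul (1 / 2)).const_mul
    (6 * (‖x - x'‖ + A))) ?_).trans ?_
  · filter_upwards [hneS, hneT] with y h1 h2
    have h3 := abs_kernel_sub_le i (sub_ne_zero.2 h1.symm) (sub_ne_zero.2 h2.symm)
    have h4 : ‖(x - S y) - (x' - T y)‖ ≤ ‖x - x'‖ + A := by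
      calc ‖(x - S y) - (x' - T y)‖ = ‖(x - x') - (S y - T y)‖ := by congr 1; abel
        _ ≤ ‖x - x'‖ + ‖S y - T y‖ := norm_sub_le _ _
        _ ≤ ‖x - x'‖ + A := by gcongr; exact hA y
    have h5 : ‖x - S y‖⁻¹ * ‖x' - T y‖⁻¹ ≤ 1 / 2 * (‖x - S y‖⁻¹ ^ 2 + ‖x' - T y‖⁻¹ ^ 2) := by
      nlinarith [sq_nonneg (‖x - S y‖⁻¹ - ‖x' - T y‖⁻¹)]
    refine h3.trans ?_
    simp only [Pi.add_apply]
    gcongr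
  · rw [integral_const_mul, integral_const_mul]
    simp only [Pi.add_apply]
    rw [integral_add iS iT]
    gcongr
    linarith

lemma abs_integral_kernel_le {ρ : Measure Space} [IsProbabilityMeasure ρ] {M : ℝ} {x : Space}
    (h : Integrable (fun y => ‖x - y‖⁻¹ ^ 2) ρ ∧ ∫ y, ‖x - y‖⁻¹ ^ 2 ∂ρ ≤ M) (i : Fin 3) :
    |∫ y, kernel i (x - y) ∂ρ| ≤ M + 1 := by
  rw [← Real.norm_eq_abs]
  refine (norm_integral_le_of_norm_le (h.1.add (integrable_const 1))
    (Eventually.of_forall fun y => ?_)).trans ?_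
  · refine (abs_kernel_le i _).trans ?_
    simp only [Pi.add_apply]
    nlinarith [sq_nonneg (‖x - y‖⁻¹ - 1)]
  · simp only [Pi.add_apply]
    rw [integral_add h.1 (integrable_const 1)]
    simpa using h.2

/-- A family of curves that start at `0`, whose velocities are bounded and at each time controlled
by the supremum of the positions over the family, vanishes. -/
lemma eq_zero_of_norm_deriv_le_sup {ι : Type*} {Z Z' : ℝ → ι → Space} {T B L : ℝ}
    (h0 : ∀ x, Z 0 x = 0)
    (hZ : ∀ t ∈ Icc 0 T, ∀ x, HasDerivWithinAt (fun s => Z s x) (Z' t x) (Ici 0) t)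
    (hB : ∀ t ∈ Icc 0 T, ∀ x, ‖Z' t x‖ ≤ B)
    (hZL : ∀ t ∈ Icc 0 T, ∀ A, (∀ y, ‖Z t y‖ ≤ A) → ∀ x, ‖Z' t x‖ ≤ L * A) :
    ∀ t ∈ Icc 0 T, ∀ x, Z t x = 0 := by
  have hcont : ∀ x, ContinuousOn (fun s => Z s x) (Icc 0 T) := fun x t ht =>
    ((hZ t ht x).continuousWithinAt).mono Icc_subset_Ici_self
  have hright : ∀ x, ∀ t ∈ Ico 0 T, HasDerivWithinAt (fun s => Z s x) (Z' t x) (Ici t) t :=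
    fun x t ht => (hZ t (Ico_subset_Icc_self ht) x).mono (Ici_subset_Ici.2 ht.1)
  -- iterating the estimate gains a factor `L t / (n + 1)` each time
  have hiter : ∀ n : ℕ, ∀ t ∈ Icc 0 T, ∀ x, ‖Z t x‖ ≤ B * T * ((L * t) ^ n / n.factorial) := by
    intro n
    induction n with
    | zero =>
      intro t ht x
      have h := norm_image_sub_le_of_norm_deriv_right_le_segment (hcont x) (hright x)
        (fun s hs => hB s (Ico_subset_Icc_self hs) x) t ht
      rw [h0, sub_zero, sub_zero] at h
      have hB0 : 0 ≤ B := (norm_nonneg _).trans (hB t ht x)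
      refine h.trans ?_
      simp only [pow_zero, Nat.factorial_zero, Nat.cast_one, div_one, mul_one]
      exact mul_le_mul_of_nonneg_left ht.2 hB0
    | succ n ih =>
      intro t ht x
      have hder : ∀ s : ℝ, HasDerivAt
          (fun s => B * T * ((L * s) ^ (n + 1) / (n + 1).factorial))
          (L * (B * T * ((L * s) ^ n / n.factorial))) s := by
        intro s
        have h := ((((hasDerivAt_id s).const_mul L).pow (n + 1)).div_const
          ((n + 1).factorial : ℝ)).const_mul (B * T)
        refine h.congr_deriv ?_
        have : (n.factorial : ℝ) ≠ 0 := by exact_mod_cast n.factorial_ne_zero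
        simp only [Nat.factorial_succ, Nat.cast_mul, Nat.cast_add, Nat.cast_one,
          Nat.add_sub_cancel, id, mul_one]
        have h2 : (n : ℝ) + 1 ≠ 0 := by positivity
        field_simp
      refine image_norm_le_of_norm_deriv_right_le_deriv_boundary (hcont x) (hright x) ?_
        hder (fun s hs => ?_) ht
      · simp [h0]
      · exact hZL s (Ico_subset_Icc_self hs) _ (ih s (Ico_subset_Icc_self hs)) x
  intro t ht x
  have hlim : Tendsto (fun n : ℕ => B * T * ((L * t) ^ n / n.factorial)) atTop (𝓝 0) := by
    simpa using (FloorSemiring.tendsto_pow_div_factorial_atTop (L * t)).const_mul (B * T)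
  have := ge_of_tendsto' hlim fun n => hiter n t ht x
  simpa using this

lemma smul_volume_mono {C D : ℝ≥0} (h : C ≤ D) {ρ : Measure Space}
    (hρ : ρ ≤ C • (volume : Measure Space)) : ρ ≤ D • (volume : Measure Space) := by
  refine hρ.trans fun s => ?_
  simp only [Measure.smul_apply, ENNReal.smul_def, smul_eq_mul]
  gcongr

/-- Solutions are determined by their initial datum. Their flows agree everywhere: by the
representation formula the difference of the velocities along two trajectories is controlled by the
largest distance of the two flows. -/
theorem IsTransportStokesSolution.unique {ρ₀ : Measure Space} {ρ σ : ℝ → Measure Space}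
    (hρ : IsTransportStokesSolution ρ₀ ρ) (hσ : IsTransportStokesSolution ρ₀ σ) {T : ℝ}
    (hT : 0 ≤ T) : ρ T = σ T := by
  obtain ⟨u, X, hu, hX0, hX, hXm, hρX⟩ := hρ.transport
  obtain ⟨v, Y, hv, hY0, hY, hYm, hσY⟩ := hσ.transport
  obtain ⟨C₁, hC₁⟩ := hρ.bounded T
  obtain ⟨C₂, hC₂⟩ := hσ.bounded T
  have hp : IsProbabilityMeasure ρ₀ := hρ.initial ▸ hρ.isProbabilityMeasure 0 le_rfl
  obtain ⟨M, hM0, hM⟩ := exists_integral_norm_inv_sq_le (max C₁ C₂)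
  have hle₁ : ∀ t ∈ Icc 0 T, ρ t ≤ max C₁ C₂ • (volume : Measure Space) := fun t ht =>
    smul_volume_mono (le_max_left _ _) (hC₁ t ht)
  have hle₂ : ∀ t ∈ Icc 0 T, σ t ≤ max C₁ C₂ • (volume : Measure Space) := fun t ht =>
    smul_volume_mono (le_max_right _ _) (hC₂ t ht)
  set c : ℝ := ∫ z, lap (lap regNorm) z with hc
  have hc0 : 0 < |c| := abs_pos.2 integral_bilaplacian_ne_zero
  have hrep₁ : ∀ t ∈ Icc 0 T, ∀ x i, u t x i * c = ∫ y, kernel i (x - y) ∂(ρ t) :=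
    fun t ht x i =>
      have := hρ.isProbabilityMeasure t ht.1
      (hu t ht.1).mul_eq_integral_kernel (hle₁ t ht) x i
  have hrep₂ : ∀ t ∈ Icc 0 T, ∀ x i, v t x i * c = ∫ y, kernel i (x - y) ∂(σ t) :=
    fun t ht x i =>
      have := hσ.isProbabilityMeasure t ht.1
      (hv t ht.1).mul_eq_integral_kernel (hle₂ t ht) x i
  have hnorm : ∀ (w : Space) (D : ℝ), (∀ i, |w i * c| ≤ D) → ‖w‖ ≤ 3 * D / |c| := by
    intro w D hD
    have h1 : ∀ i, |w i| ≤ D / |c| := fun i => by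
      rw [le_div_iff₀ hc0, ← abs_mul]
      exact hD i
    refine (norm_le_sum_abs_coord w).trans ((Finset.sum_le_sum fun i _ => h1 i).trans ?_)
    simp
    exact (mul_div_assoc _ _ _).ge
  have hzero := eq_zero_of_norm_deriv_le_sup (Z := fun t x => X t x - Y t x)
    (Z' := fun t x => u t (X t x) - v t (Y t x)) (T := T) (B := 3 * (2 * (M + 1)) / |c|)
    (L := 3 * (12 * M) / |c|) (fun x => by simp [hX0, hY0])
    (fun t ht x => (hX t ht.1 x).sub (hY t ht.1 x))
    (fun t ht x => hnorm _ _ fun i => by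
      have := hρ.isProbabilityMeasure t ht.1
      have := hσ.isProbabilityMeasure t ht.1
      rw [PiLp.sub_apply, sub_mul, hrep₁ t ht, hrep₂ t ht]
      refine (abs_sub _ _).trans ?_
      have h1 := abs_integral_kernel_le (hM (ρ t) inferInstance (hle₁ t ht) (X t x)) i
      have h2 := abs_integral_kernel_le (hM (σ t) inferInstance (hle₂ t ht) (Y t x)) i
      linarith)
    (fun t ht A hA x => by
      have h := hnorm (u t (X t x) - v t (Y t x)) (12 * M * A) fun i => by
        rw [PiLp.sub_apply, sub_mul, hrep₁ t ht, hrep₂ t ht, hρX t ht.1, hσY t ht.1]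
        refine (abs_integral_kernel_sub_le hM (hXm t ht.1) (hYm t ht.1)
          (hρX t ht.1 ▸ hle₁ t ht) (hσY t ht.1 ▸ hle₂ t ht) hA _ _ i).trans ?_
        have := hA x
        nlinarith
      refine h.trans (le_of_eq ?_)
      ring)
  rw [hρX T hT, hσY T hT]
  congr 1
  funext x
  exact sub_eq_zero.1 (hzero T ⟨hT, le_rfl⟩ x)

/-! ### Wasserstein distances of balls and instability -/

lemma map_patch_one {R : ℝ} (hR : 0 < R) (a : Space) :
    (patch 1).map (fun x => R • x + a) = uniformBall a R := by
  have hT : Measurable fun x : Space => R • x + a := by fun_prop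
  have hpre : (fun x : Space => R • x + a) ⁻¹' ball a R = ball 0 1 := by
    ext x
    simp [norm_smul, abs_of_pos hR, mul_lt_iff_lt_one_right hR]
  have hvol : (volume : Measure Space).map (fun x => R • x + a) =
      ENNReal.ofReal (R ^ 3)⁻¹ • (volume : Measure Space) := by
    have h : (fun x : Space => R • x + a) = (· + a) ∘ (R • ·) := rfl
    rw [h, ← Measure.map_map (by fun_prop) (by fun_prop), Measure.map_addHaar_smul _ hR.ne',
      Measure.map_smul, (measurePreserving_add_right volume a).map_eq, finrank_euclideanSpace_fin,
      abs_of_pos (by positivity)]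
  have hball : volume (ball a R) = ENNReal.ofReal (R ^ 3) * volume (ball (0 : Space) 1) := by
    rw [Measure.addHaar_ball _ _ hR.le, finrank_euclideanSpace_fin]
  have hres := Measure.restrict_map (μ := (volume : Measure Space)) hT
    (measurableSet_ball (x := a) (ε := R))
  rw [hpre, hvol] at hres
  rw [patch, uniformBall, Measure.map_smul, ← hres, Measure.restrict_smul, smul_smul, uniformBall,
    hball, ENNReal.mul_inv (Or.inr measure_ball_lt_top.ne) (Or.inl ENNReal.ofReal_ne_top),
    ENNReal.ofReal_inv_of_pos (by positivity), mul_comm]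

lemma integrable_patch {f : Space → ℝ} (hf : Continuous f) : Integrable f (patch 1) := by
  refine Integrable.smul_measure ?_ (ENNReal.inv_ne_top.2 (volume_ball_ne_zero one_pos 0))
  exact (hf.continuousOn.integrableOn_compact (isCompact_closedBall (0 : Space) 1)).mono_set
    ball_subset_closedBall

lemma integral_uniformBall {R : ℝ} (hR : 0 < R) (a : Space) {f : Space → ℝ} (hf : Continuous f) :
    ∫ x, f x ∂(uniformBall a R) = ∫ x, f (R • x + a) ∂(patch 1) := by
  rw [← map_patch_one hR, integral_map (by fun_prop) hf.aestronglyMeasurable]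

lemma integrable_uniformBall {R : ℝ} (hR : 0 < R) (a : Space) {f : Space → ℝ} (hf : Continuous f) :
    Integrable f (uniformBall a R) := by
  rw [← map_patch_one hR, integrable_map_measure hf.aestronglyMeasurable (by fun_prop)]
  exact integrable_patch (hf.comp (by fun_prop))

lemma integral_coord_patch (i : Fin 3) : ∫ x, x i ∂(patch 1) = 0 := by
  have h : (patch 1).map (fun x => -x) = patch 1 :=
    uniformBall_map (Measure.measurePreserving_neg volume) (by ext x; simp)
  have h1 : ∫ x, x i ∂((patch 1).map fun x => -x) = ∫ x : Space, (-x) i ∂(patch 1) :=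
    integral_map (by fun_prop) (by fun_prop)
  simp only [h, PiLp.neg_apply, integral_neg] at h1
  linarith

lemma integral_coord_uniformBall {R : ℝ} (hR : 0 < R) (a : Space) (i : Fin 3) :
    ∫ x, x i ∂(uniformBall a R) = a i := by
  have hp : IsProbabilityMeasure (patch 1) := isProbabilityMeasure_uniformBall 0 one_pos
  have hc : Continuous fun x : Space => x i := by fun_prop
  rw [integral_uniformBall hR a hc]
  simp only [PiLp.add_apply, PiLp.smul_apply, smul_eq_mul]
  rw [integral_add ((integrable_patch hc).const_mul R) (integrable_const _), integral_const_mul,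
    integral_coord_patch]
  simp

lemma W₁_uniformBall_le {R R' : ℝ} (hR : 0 < R) (hR' : 0 < R') (a a' : Space) :
    W₁ (uniformBall a' R') (uniformBall a R) ≤
      ENNReal.ofReal (|R' - R| * (∫ x, ‖x‖ ∂(patch 1)) + ‖a' - a‖) := by
  have hp : IsProbabilityMeasure (patch 1) := isProbabilityMeasure_uniformBall 0 one_pos
  refine iSup_le fun f => iSup_le fun hf => iSup_le fun _ => iSup_le fun _ =>
    ENNReal.ofReal_le_ofReal ?_
  have hint := integrable_patch continuous_norm
  have hfi : ∀ (r : ℝ) (b : Space), Integrable (fun x => f (r • x + b)) (patch 1) := fun r b =>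
    integrable_patch (hf.continuous.comp (by fun_prop))
  rw [integral_uniformBall hR' a' hf.continuous, integral_uniformBall hR a hf.continuous,
    ← integral_sub (hfi R' a') (hfi R a), ← Real.norm_eq_abs]
  refine (norm_integral_le_of_norm_le ((hint.const_mul |R' - R|).add
    (integrable_const ‖a' - a‖)) (Eventually.of_forall fun x => ?_)).trans (le_of_eq ?_)
  · have h1 := hf.dist_le_mul (R' • x + a') (R • x + a)
    rw [NNReal.coe_one, one_mul, dist_eq_norm, dist_eq_norm] at h1
    refine h1.trans ?_
    have h2 : R' • x + a' - (R • x + a) = (R' - R) • x + (a' - a) := by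
      rw [sub_smul]
      abel
    rw [h2]
    refine (norm_add_le _ _).trans ?_
    rw [norm_smul, Real.norm_eq_abs]
    rfl
  · simp only [Pi.add_apply]
    rw [integral_add (hint.const_mul _) (integrable_const _), integral_const_mul]
    simp

/-- The Wasserstein distance of two balls is at least the difference of the heights of their
centres. -/
lemma le_W₁_uniformBall {R R' : ℝ} (hR : 0 < R) (hR' : 0 < R') (a a' : Space) (i : Fin 3) :
    ENNReal.ofReal |a' i - a i| ≤ W₁ (uniformBall a' R') (uniformBall a R) := by
  have hc : Continuous fun x : Space => x i := by fun_prop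
  have hl : LipschitzWith 1 fun x : Space => x i := LipschitzWith.of_dist_le_mul fun x y => by
    rw [NNReal.coe_one, one_mul, Real.dist_eq, dist_eq_norm]
    exact abs_coord_le_norm (x - y) i
  refine le_trans ?_ (le_iSup_of_le (fun x : Space => x i) (le_iSup_of_le hl
    (le_iSup_of_le (integrable_uniformBall hR' a' hc)
      (le_iSup_of_le (integrable_uniformBall hR a hc) le_rfl))))
  rw [integral_coord_uniformBall hR', integral_coord_uniformBall hR]

lemma waveCenter_sub (R R' t : ℝ) : waveCenter R' t - waveCenter R t =
    (-(4 / 15 * (t / volume.real (ball (0 : Space) 1)) * (1 / R' - 1 / R))) • e₃ := by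
  rw [waveCenter, waveCenter, ← sub_smul, smul_smul]
  congr 1
  simp only [div_eq_mul_inv, mul_inv]
  ring

lemma norm_waveCenter_sub (R R' : ℝ) {t : ℝ} (ht : 0 ≤ t) : ‖waveCenter R' t - waveCenter R t‖ =
    4 / 15 * (t / volume.real (ball (0 : Space) 1)) * |1 / R' - 1 / R| := by
  have := volume_real_ball_pos
  rw [waveCenter_sub, norm_smul, e₃_eq, norm_unitVec, mul_one, norm_neg, norm_mul,
    Real.norm_of_nonneg (by positivity), Real.norm_eq_abs]

lemma abs_waveCenter_sub (R R' : ℝ) {t : ℝ} (ht : 0 ≤ t) :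
    |waveCenter R' t 2 - waveCenter R t 2| =
      4 / 15 * (t / volume.real (ball (0 : Space) 1)) * |1 / R' - 1 / R| := by
  have := volume_real_ball_pos
  rw [← PiLp.sub_apply, waveCenter_sub, PiLp.smul_apply, e₃_eq, unitVec_apply, if_pos rfl,
    smul_eq_mul, mul_one, abs_neg, abs_mul, abs_of_nonneg (by positivity)]

theorem isUniqueTransportStokesSolution_travelingWave {R : ℝ} (hR : 0 < R) :
    IsUniqueTransportStokesSolution (patch R) (travelingWave R) :=
  ⟨isTransportStokesSolution_travelingWave hR, fun _ hσ _ ht =>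
    hσ.unique (isTransportStokesSolution_travelingWave hR) ht⟩

lemma W₁_patch_le {R R' : ℝ} (hR : 0 < R) (hR' : 0 < R') :
    W₁ (patch R') (patch R) ≤ ENNReal.ofReal (|R' - R| * ∫ x, ‖x‖ ∂(patch 1)) := by
  have h := W₁_uniformBall_le hR hR' 0 0
  rwa [sub_zero, norm_zero, add_zero] at h

lemma le_W₁_travelingWave {R R' : ℝ} (hR : 0 < R) (hR' : 0 < R') {t : ℝ} (ht : 0 ≤ t) :
    ENNReal.ofReal (4 / 15 * (t / volume.real (ball (0 : Space) 1)) * |1 / R' - 1 / R|) ≤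
      W₁ (travelingWave R' t) (travelingWave R t) := by
  have h := le_W₁_uniformBall hR hR' (waveCenter R t) (waveCenter R' t) 2
  rwa [abs_waveCenter_sub R R' ht] at h

/-- Balls of slightly larger radius are close initially, but move at a different speed. -/
lemma isW₁Unstable_travelingWave {R : ℝ} (hR : 0 < R) : IsW₁Unstable (travelingWave R) := by
  refine ⟨1, one_pos, fun η hη => ?_⟩
  have hlim : Tendsto (fun δ : ℝ => ENNReal.ofReal (|R + δ - R| * ∫ x, ‖x‖ ∂(patch 1))) (𝓝[>] 0)
      (𝓝 0) := by
    have hc : Continuous fun δ : ℝ => ENNReal.ofReal (|R + δ - R| * ∫ x, ‖x‖ ∂(patch 1)) :=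
      ENNReal.continuous_ofReal.comp (by fun_prop)
    have := (hc.tendsto 0).mono_left (nhdsWithin_le_nhds (s := Ioi 0))
    simpa using this
  obtain ⟨δ, h1, h2⟩ := ((hlim.eventually_lt_const hη).and self_mem_nhdsWithin).exists
  have hδ : 0 < δ := h2
  have hR' : 0 < R + δ := by positivity
  refine ⟨patch (R + δ), travelingWave (R + δ), isBoundedProbability_patch hR',
    isUniqueTransportStokesSolution_travelingWave hR', ?_, ?_⟩
  · rw [travelingWave_zero]
    exact (W₁_patch_le hR hR').trans_lt h1
  · have hV := volume_real_ball_pos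
    have hne : 1 / (R + δ) - 1 / R ≠ 0 := by
      have : 1 / (R + δ) < 1 / R := one_div_lt_one_div_of_lt hR (by linarith)
      linarith
    set κ : ℝ := 4 / 15 * (1 / volume.real (ball (0 : Space) 1)) * |1 / (R + δ) - 1 / R| with hκ
    have hκ0 : 0 < κ := by
      have := abs_pos.2 hne
      positivity
    refine ⟨2 / κ, by positivity, fun t ht => ?_⟩
    have ht0 : 0 ≤ t := le_trans (by positivity) ht
    refine lt_of_lt_of_le ?_ (le_W₁_travelingWave hR hR' ht0)
    rw [ENNReal.one_lt_ofReal]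
    rw [div_le_iff₀ hκ0] at ht
    calc (1 : ℝ) < t * κ := by linarith
      _ = _ := by rw [hκ]; ring

theorem mainTheorem1 (R : ℝ) (hR : 0 < R) :
    IsUniqueTransportStokesSolution (patch R) (travelingWave R) ∧
    IsW₁Unstable (travelingWave R) ∧
    ∀ R' : ℝ, 0 < R' →
      IsUniqueTransportStokesSolution (patch R') (travelingWave R') ∧
      W₁ (patch R') (patch R) ≤ ENNReal.ofReal (|R' - R| * ∫ x, ‖x‖ ∂(patch 1)) ∧
      ∀ t : ℝ, 0 ≤ t →
        ENNReal.ofReal (4 / 15 * (t / volume.real (ball (0 : Space) 1)) * |1 / R' - 1 / R|)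
            ≤ W₁ (travelingWave R' t) (travelingWave R t) ∧
        W₁ (travelingWave R' t) (travelingWave R t) ≤
          ENNReal.ofReal (|R' - R| * (∫ x, ‖x‖ ∂(patch 1)) +
            4 / 15 * (t / volume.real (ball (0 : Space) 1)) * |1 / R' - 1 / R|) := by
  refine ⟨isUniqueTransportStokesSolution_travelingWave hR, isW₁Unstable_travelingWave hR,
    fun R' hR' => ⟨isUniqueTransportStokesSolution_travelingWave hR', W₁_patch_le hR hR',
      fun t ht => ⟨le_W₁_travelingWave hR hR' ht, ?_⟩⟩⟩
  have h := W₁_uniformBall_le hR hR' (waveCenter R t) (waveCenter R' t)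
  rwa [norm_waveCenter_sub R R' ht] at h
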